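/- A rooted labeled tree on $[n]=\{1,\dots,n\}$ is a tree with node set $[n]$ and a distinguished root. A node $z$ is a descendant of $x$ if $x$ lies on the path from $z$ to the root (so $x$ is a descendant of itself). Let $T_x$ be the subtree formed by the descendants of $x$ and $\beta(x)$ its smallest node. The degree $\deg(x)$ is the number of children of $x$. An edge with father $x$ and child $y$ is proper if $x<\beta(y)$, and improper otherwise. Let $\mathcal R_{n,k}$ be the set of rooted labeled trees on $[n]$ with exactly $k$ improper edges, and $\mathcal R_{n,k}^{(i)}$ the subset of those with exactly $i$ proper edges on the path from the node $n$ to the root; conditions in square brackets select the trees satisfying them. If $\deg(n)>0$, the lower critical node $\lambda$ is the first node $u\neq n$ on the path from $n$ to $\beta(n)$ such that $u$ is smaller than every node of $T_n$ that is not in $T_u$ (such a node exists, since $\beta(n)$ qualifies). **Theorem.** Let $n\ge 1$ and $k\ge 0$. For every $m\ge 1$ there is a bijection $$\mathcal R_{n,k}^{(0)}[\deg(1)=m]\;\longleftrightarrow\;\mathcal R_{n,k+1}^{(m-1)}[\deg(n)>0,\ \deg(1)=0,\ \lambda>1].$$ Moreover, there is a bijection $\Phi:\mathcal R_{n,k}[\deg(1)>0]\to\mathcal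 R_{n,k+1}[\deg(n)>0]$ that, for every $m\ge 1$, restricts to a bijection between the two sets above and, for every $i\ge 1$, restricts to a bijection $$\mathcal R_{n,k}^{(i)}[\deg(1)>0]\;\longleftrightarrow\;\mathcal R_{n,k+1}^{(i-1)}[\deg(n)>0,\ (\deg(1)>0\text{ or }\lambda=1)].$$ -/

import Mathlib

/-- A rooted labeled tree whose set of nodes is `V`, given by its root and its father map: every
node other than the root has exactly one father, and every node reaches the root by passing to
fathers.  The father of the root is set to be the root itself; this is not an edge.
The edges of the tree are the pairs `(parent y, y)` with `y ≠ root`. -/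
@[ext]
structure RootedLabeledTree (V : Type*) where
  root : V
  parent : V → V
  parent_root : parent root = root
  exists_iterate_parent_eq_root : ∀ x, ∃ j : ℕ, parent^[j] x = root

namespace RootedLabeledTree

section Descendant

variable {V : Type*} (T : RootedLabeledTree V)

/-- `z` is a descendant of `x` (every node is a descendant of itself). -/
def IsDescendant (z x : V) : Prop := ∃ j : ℕ, T.parent^[j] z = x

theorem IsDescendant.rfl {x : V} : T.IsDescendant x x := ⟨0, by simp⟩

theorem IsDescendant.trans {x y z : V} (h₁ : T.IsDescendant x y) (h₂ : T.IsDescendant y z) :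
    T.IsDescendant x z := by
  obtain ⟨i, rfl⟩ := h₁
  obtain ⟨j, rfl⟩ := h₂
  exact ⟨j + i, Function.iterate_add_apply _ _ _ _⟩

theorem IsDescendant.total {z x y : V} (h₁ : T.IsDescendant z x) (h₂ : T.IsDescendant z y) :
    T.IsDescendant x y ∨ T.IsDescendant y x := by
  obtain ⟨i, rfl⟩ := h₁
  obtain ⟨j, rfl⟩ := h₂
  rcases le_total i j with h | h
  · exact Or.inl ⟨j - i, by rw [← Function.iterate_add_apply, Nat.sub_add_cancel h]⟩
  · exact Or.inr ⟨i - j, by rw [← Function.iterate_add_apply, Nat.sub_add_cancel h]⟩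

theorem iterate_parent_root (j : ℕ) : T.parent^[j] T.root = T.root :=
  Function.iterate_fixed T.parent_root j

theorem IsDescendant.antisymm {x y : V} (h₁ : T.IsDescendant x y) (h₂ : T.IsDescendant y x) :
    x = y := by
  obtain ⟨i, rfl⟩ := h₁
  obtain ⟨j, hj⟩ := h₂
  rcases Nat.eq_zero_or_pos i with rfl | hi
  · simp
  have hper : Function.IsPeriodicPt T.parent (j + i) x := by
    rw [Function.IsPeriodicPt, Function.IsFixedPt, Function.iterate_add_apply, hj]
  obtain ⟨d, hd⟩ := T.exists_iterate_parent_eq_root x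
  have h := (hper.const_mul d).eq
  have hle : d ≤ d * (j + i) := Nat.le_mul_of_pos_right d (by omega)
  have hx : x = T.root := by
    rw [← h, ← Nat.sub_add_cancel hle, Function.iterate_add_apply, hd, T.iterate_parent_root]
  subst hx
  exact (T.iterate_parent_root i).symm

end Descendant

section Statistics

variable {V : Type*} [Fintype V] (T : RootedLabeledTree V)

open Classical in
/-- The set of nodes of the subtree `T_x`, namely the descendants of `x`. -/
noncomputable def subtree (x : V) : Finset V := {z | T.IsDescendant z x}

theorem mem_subtree {x z : V} : z ∈ T.subtree x ↔ T.IsDescendant z x := by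
  simp [subtree]

theorem subtree_nonempty (x : V) : (T.subtree x).Nonempty :=
  ⟨x, T.mem_subtree.2 (IsDescendant.rfl T)⟩

variable [LinearOrder V]

/-- `β(x)`: the smallest node of the subtree `T_x`. -/
noncomputable def beta (x : V) : V := (T.subtree x).min' (T.subtree_nonempty x)

theorem beta_mem (x : V) : T.beta x ∈ T.subtree x := Finset.min'_mem _ _

theorem beta_le {x z : V} (h : z ∈ T.subtree x) : T.beta x ≤ z := Finset.min'_le _ _ h

/-- The edge with child node `y` (so `y` is not the root) and father node `parent y`
is proper: the father node is smaller than every node of `T_y`. -/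
def IsProper (y : V) : Prop := y ≠ T.root ∧ T.parent y < T.beta y

/-- The edge with child node `y` is improper. -/
def IsImproper (y : V) : Prop := y ≠ T.root ∧ ¬ T.parent y < T.beta y

open Classical in
/-- The number of improper edges of the tree. -/
noncomputable def numImproper : ℕ := (Finset.univ.filter fun y => T.IsImproper y).card

open Classical in
/-- The degree of a node: the number of its children. -/
noncomputable def deg (x : V) : ℕ :=
  (Finset.univ.filter fun y => y ≠ T.root ∧ T.parent y = x).card

open Classical in
/-- The number of proper edges on the path from `x` to the root; the edges on this path are
those whose child node is an ancestor of `x` (possibly `x` itself). -/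
noncomputable def numProperOnPath (x : V) : ℕ :=
  (Finset.univ.filter fun y => T.IsDescendant x y ∧ T.IsProper y).card

variable [BoundedOrder V]

/-- `u` is a node other than the maximum node `n = ⊤`, it lies on the path from `n` down to
`β(n)`, and it is smaller than every node of `T_n - T_u`. -/
def IsLowerCriticalCandidate (u : V) : Prop :=
  u ≠ ⊤ ∧ T.IsDescendant u ⊤ ∧ T.IsDescendant (T.beta ⊤) u ∧
    ∀ z ∈ T.subtree ⊤ \ T.subtree u, u < z

/-- `u` is the lower critical node `λ(T)`: the first candidate that is met on the path from the
maximum node `n = ⊤` down to `β(n)`.  It exists, and is then unique, if and only if `deg n > 0`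
(see `existsUnique_isLowerCritical` and `IsLowerCritical.deg_pos`). -/
def IsLowerCritical (u : V) : Prop :=
  T.IsLowerCriticalCandidate u ∧ ∀ w, T.IsLowerCriticalCandidate w → T.IsDescendant w u

theorem isLowerCriticalCandidate_beta (h : 0 < T.deg ⊤) :
    T.IsLowerCriticalCandidate (T.beta ⊤) := by
  have hmem := T.mem_subtree.1 (T.beta_mem ⊤)
  refine ⟨?_, hmem, IsDescendant.rfl T, ?_⟩
  · obtain ⟨y, hy⟩ := Finset.card_pos.1 h
    simp only [Finset.mem_filter, Finset.mem_univ, true_and] at hy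
    have hyd : T.IsDescendant y ⊤ := ⟨1, by simpa using hy.2⟩
    have hle := T.beta_le (T.mem_subtree.2 hyd)
    intro htop
    rw [htop, top_le_iff] at hle
    subst hle
    apply hy.1
    obtain ⟨j, hj⟩ := T.exists_iterate_parent_eq_root ⊤
    rw [Function.iterate_fixed hy.2] at hj
    exact hj
  · intro z hz
    rw [Finset.mem_sdiff] at hz
    refine lt_of_le_of_ne (T.beta_le hz.1) ?_
    rintro rfl
    exact hz.2 (T.mem_subtree.2 (IsDescendant.rfl T))

theorem existsUnique_isLowerCritical (h : 0 < T.deg ⊤) : ∃! u, T.IsLowerCritical u := by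
  classical
  obtain ⟨u, hu, hmax⟩ := Finset.exists_max_image
    (Finset.univ.filter fun u => T.IsLowerCriticalCandidate u) (fun u => (T.subtree u).card)
    ⟨T.beta ⊤, by simpa using T.isLowerCriticalCandidate_beta h⟩
  simp only [Finset.mem_filter, Finset.mem_univ, true_and] at hu hmax
  refine ⟨u, ⟨hu, fun w hw => ?_⟩, fun w hw => ?_⟩
  · rcases IsDescendant.total T hw.2.2.1 hu.2.2.1 with hd | hd
    · exact hd
    · have hsub : T.subtree u ⊆ T.subtree w := fun z hz =>
        T.mem_subtree.2 (IsDescendant.trans T (T.mem_subtree.1 hz) hd)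
      have heq := Finset.eq_of_subset_of_card_le hsub (hmax w hw)
      exact T.mem_subtree.1 (heq ▸ T.mem_subtree.2 (IsDescendant.rfl T))
  · rcases IsDescendant.total T hw.1.2.2.1 hu.2.2.1 with hd | hd
    · have hcard : (T.subtree w).card ≤ (T.subtree u).card := hmax w hw.1
      exact IsDescendant.antisymm T hd (hw.2 u hu)
    · have hsub : T.subtree u ⊆ T.subtree w := fun z hz =>
        T.mem_subtree.2 (IsDescendant.trans T (T.mem_subtree.1 hz) hd)
      have heq := Finset.eq_of_subset_of_card_le hsub (hmax w hw.1)
      exact IsDescendant.antisymm T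
        (T.mem_subtree.1 (heq ▸ T.mem_subtree.2 (IsDescendant.rfl T))) hd

theorem IsLowerCritical.deg_pos {u : V} (h : T.IsLowerCritical u) : 0 < T.deg ⊤ := by
  obtain ⟨⟨hne, ⟨j, hj⟩, -, -⟩, -⟩ := h
  induction j generalizing u with
  | zero => exact absurd (by simpa using hj) hne
  | succ j ih =>
    rw [Function.iterate_succ_apply] at hj
    by_cases hp : T.parent u = ⊤
    · refine Finset.card_pos.2 ⟨u, ?_⟩
      simp only [Finset.mem_filter, Finset.mem_univ, true_and]
      refine ⟨?_, hp⟩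
      rintro rfl
      exact hne (T.parent_root.symm.trans hp)
    · exact ih hp hj

end Statistics

end RootedLabeledTree

/-- `RTrees n k`: the set of rooted labeled trees on `[n]` with `k` improper edges.
The node set `[n] = {1, …, n}` is modelled by `Fin n` with its usual order, so that
for `n ≥ 1` the node `1` is `⊥ : Fin n` and the node `n` is `⊤ : Fin n`. -/
def RTrees (n k : ℕ) : Set (RootedLabeledTree (Fin n)) := {T | T.numImproper = k}

/-- `RTreesPath n k i`: the set of trees in `RTrees n k` with exactly `i` proper edges on the path
from the node `n` to the root. -/
def RTreesPath (n k i : ℕ) [NeZero n] : Set (RootedLabeledTree (Fin n)) :=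
  {T | T ∈ RTrees n k ∧ T.numProperOnPath ⊤ = i}

/-! Two independent constructions are composed. The first, `lower`, acts on trees with a proper edge
on the path from `⊤` to the root. Let `y` be the child of the lowest such edge and `x` its father.
Reversing the path from `⊤` up to `x` puts `⊤` in the place of `x`. Since `x` is smaller than all of
`T_y`, every reversed edge is improper, whereas exactly one edge of the old path was proper. So one
improper edge is gained and one proper edge above `⊤` is lost. Moreover `x` becomes the lower
critical node, so the reversal can be undone. A child of `⊥` survives unless `x = ⊥`, which is the
case `λ = 1` (`IsLowestProper.deg_bot_pos_iff`). The second, a permutation `τ` of all trees,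
exchanges `deg ⊥` with the number of proper edges above `⊤` when one of them is zero, and keeps both
otherwise (`exists_perm_swap_deg_bot`). Thus `deg ⊥ > 0` turns into the existence of a proper edge
above `⊤`, and `lower ∘ τ` is the required map; `i ≥ 1` and `i = 0` correspond to whether `τ` keeps
or exchanges the two numbers. For `τ`, the count above `⊤` is replaced by `numProperNear x`, which
makes sense for every label and agrees with it at `⊤`. Passing from a label to its successor is a
bijection of trees (`transpose`): swap the two labels if no edge changes its status, and otherwise
swap the suitable children of the two nodes. This reduces the task to the successor of `⊥`, where
the two numbers count children of the two smallest nodes and can be exchanged directly. -/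

namespace RootedLabeledTree

/-! ### Paths to the root. -/

section Descendants

variable {V : Type*} (T : RootedLabeledTree V)

theorem isDescendant_refl (x : V) : T.IsDescendant x x := IsDescendant.rfl T

theorem isDescendant_parent (x : V) : T.IsDescendant x (T.parent x) := ⟨1, rfl⟩

theorem isDescendant_root (x : V) : T.IsDescendant x T.root :=
  T.exists_iterate_parent_eq_root x

variable {T}

theorem IsDescendant.eq_or_parent {z w : V} (h : T.IsDescendant z w) :
    z = w ∨ T.IsDescendant (T.parent z) w := by
  obtain ⟨_ | j, hj⟩ := h
  · exact Or.inl hj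
  · exact Or.inr ⟨j, hj⟩

theorem IsDescendant.parent_of_ne {z w : V} (h : T.IsDescendant z w) (hne : z ≠ w) :
    T.IsDescendant (T.parent z) w :=
  h.eq_or_parent.resolve_left hne

theorem isDescendant_iff {z w : V} :
    T.IsDescendant z w ↔ z = w ∨ T.IsDescendant (T.parent z) w := by
  refine ⟨IsDescendant.eq_or_parent, ?_⟩
  rintro (rfl | h)
  · exact T.isDescendant_refl z
  · exact IsDescendant.trans T (T.isDescendant_parent z) h

theorem isDescendant_root_iff {w : V} : T.IsDescendant T.root w ↔ T.root = w :=
  ⟨fun h => IsDescendant.antisymm T h (T.isDescendant_root w),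
    fun h => h ▸ T.isDescendant_refl _⟩

theorem IsDescendant.ne_root {z w : V} (h : T.IsDescendant z w) (hne : z ≠ w) : z ≠ T.root := by
  rintro rfl
  exact hne (isDescendant_root_iff.1 h)

theorem not_isDescendant_parent {y : V} (hy : y ≠ T.root) : ¬ T.IsDescendant (T.parent y) y := by
  intro h
  have h1 := IsDescendant.antisymm T (T.isDescendant_parent y) h
  obtain ⟨j, hj⟩ := T.exists_iterate_parent_eq_root y
  rw [Function.iterate_fixed h1.symm] at hj
  exact hy hj

theorem parent_ne_self {y : V} (hy : y ≠ T.root) : T.parent y ≠ y := fun h =>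
  not_isDescendant_parent hy (by rw [h]; exact T.isDescendant_refl y)

theorem IsDescendant.exists_child {z w : V} (h : T.IsDescendant z w) (hne : z ≠ w) :
    ∃ c, c ≠ T.root ∧ T.parent c = w ∧ T.IsDescendant z c := by
  obtain ⟨j, hj⟩ := h
  induction j generalizing z with
  | zero => exact absurd hj hne
  | succ j ih =>
    by_cases hp : T.parent z = w
    · exact ⟨z, IsDescendant.ne_root ⟨j + 1, hj⟩ hne, hp, T.isDescendant_refl z⟩
    · obtain ⟨c, h1, h2, h3⟩ := ih hp hj
      exact ⟨c, h1, h2, IsDescendant.trans T (T.isDescendant_parent z) h3⟩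

theorem child_unique {z c d : V} (hc : c ≠ T.root) (hd : d ≠ T.root)
    (h : T.parent c = T.parent d) (hzc : T.IsDescendant z c) (hzd : T.IsDescendant z d) :
    c = d := by
  by_contra hne
  rcases IsDescendant.total T hzc hzd with h1 | h1
  · exact not_isDescendant_parent hd (h ▸ h1.parent_of_ne hne)
  · exact not_isDescendant_parent hc (h ▸ h1.parent_of_ne (Ne.symm hne))

theorem parent_induction {p : V → Prop} (hroot : p T.root)
    (hstep : ∀ z, z ≠ T.root → p (T.parent z) → p z) (z : V) : p z := by
  obtain ⟨j, hj⟩ := T.exists_iterate_parent_eq_root z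
  induction j generalizing z with
  | zero =>
    obtain rfl : z = T.root := hj
    exact hroot
  | succ j ih =>
    by_cases hz : z = T.root
    · exact hz ▸ hroot
    · exact hstep z hz (ih _ hj)

/-- A predicate that satisfies the recursion of "descendant of `w`" along fathers is that
property. -/
theorem isDescendant_iff_of_rec {D : V → Prop} {w : V} (hroot : D T.root ↔ T.root = w)
    (hstep : ∀ z, z ≠ T.root → (D z ↔ z = w ∨ D (T.parent z))) (z : V) :
    T.IsDescendant z w ↔ D z := by
  induction z using parent_induction (T := T) with
  | hroot => rw [isDescendant_root_iff, hroot]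
  | hstep z hz ih => rw [isDescendant_iff, hstep z hz, ih]

end Descendants

/-! ### Properness and the counted statistics. -/

section Statistics

variable {V : Type*} [Fintype V] [LinearOrder V] (T : RootedLabeledTree V)

variable {T} in
theorem isProper_iff {y : V} :
    T.IsProper y ↔ y ≠ T.root ∧ ∀ z, T.IsDescendant z y → T.parent y < z := by
  simp only [IsProper, beta, Finset.lt_min'_iff, mem_subtree]

variable {T} in
theorem isImproper_iff {y : V} : T.IsImproper y ↔ y ≠ T.root ∧ ¬ T.IsProper y := by
  unfold IsImproper IsProper
  tauto

variable {T} in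
theorem IsProper.parent_lt {y z : V} (h : T.IsProper y) (hz : T.IsDescendant z y) :
    T.parent y < z :=
  (isProper_iff.1 h).2 z hz

theorem numImproper_eq_ncard : T.numImproper = {y | T.IsImproper y}.ncard := by
  rw [numImproper, ← Set.ncard_coe_finset]
  congr 1
  ext
  simp

theorem deg_eq_ncard (x : V) : T.deg x = {y | y ≠ T.root ∧ T.parent y = x}.ncard := by
  rw [deg, ← Set.ncard_coe_finset]
  congr 1
  ext
  simp

theorem numProperOnPath_eq_ncard (x : V) :
    T.numProperOnPath x = {y | T.IsDescendant x y ∧ T.IsProper y}.ncard := by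
  rw [numProperOnPath, ← Set.ncard_coe_finset]
  congr 1
  ext
  simp

theorem deg_pos_iff {x : V} : 0 < T.deg x ↔ ∃ y, y ≠ T.root ∧ T.parent y = x := by
  rw [deg_eq_ncard, Set.ncard_pos]
  rfl

theorem numProperOnPath_pos_iff {x : V} :
    0 < T.numProperOnPath x ↔ ∃ y, T.IsDescendant x y ∧ T.IsProper y := by
  rw [numProperOnPath_eq_ncard, Set.ncard_pos]
  rfl

/-- The number of proper edges that lie on the path from `x` to the root or have father `x`. -/
noncomputable def numProperNear (x : V) : ℕ :=
  {y | T.IsProper y ∧ (T.IsDescendant x y ∨ T.parent y = x)}.ncard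

/-- A proper edge has a child larger than its father, so none has father `⊤`. The extra term of
`numProperNear` only matters for smaller labels. -/
theorem numProperNear_top [BoundedOrder V] : T.numProperNear ⊤ = T.numProperOnPath ⊤ := by
  rw [numProperNear, numProperOnPath_eq_ncard]
  congr 1
  ext y
  constructor
  · rintro ⟨h, h1 | h1⟩
    · exact ⟨h1, h⟩
    · exact absurd (h.parent_lt (T.isDescendant_refl y)) (by simp [h1])
  · rintro ⟨h1, h⟩
    exact ⟨h, Or.inl h1⟩

end Statistics

end RootedLabeledTree

namespace RootedLabeledTree

/-! ### Exchanging the children of two nodes. -/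

section Exchange

variable {V : Type*} [LinearOrder V] (T : RootedLabeledTree V)

/-- `z` is a child of `x` or of `y`, and all nodes of `T_z` are larger than `y`. -/
def IsMovable (x y z : V) : Prop :=
  z ≠ T.root ∧ (T.parent z = x ∨ T.parent z = y) ∧ ∀ w, T.IsDescendant w z → y < w

/-- `z` lies in a subtree `T_m` with `m` movable. -/
def InMovable (x y z : V) : Prop := ∃ m, T.IsMovable x y m ∧ T.IsDescendant z m

open Classical in
/-- The father map after the movable children of `x` and those of `y` have been exchanged. -/
noncomputable def exchangeParent (x y z : V) : V :=
  if T.IsMovable x y z then Equiv.swap x y (T.parent z) else T.parent z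

variable {T} {x y : V}

theorem IsMovable.inMovable {z : V} (h : T.IsMovable x y z) : T.InMovable x y z :=
  ⟨z, h, T.isDescendant_refl z⟩

theorem InMovable.of_isDescendant {z w : V} (h : T.InMovable x y w) (hz : T.IsDescendant z w) :
    T.InMovable x y z :=
  h.imp fun _ hm => ⟨hm.1, IsDescendant.trans T hz hm.2⟩

theorem InMovable.lt {z : V} (h : T.InMovable x y z) : y < z := by
  obtain ⟨m, hm, hz⟩ := h
  exact hm.2.2 z hz

theorem not_inMovable_of_le {z : V} (h : z ≤ y) : ¬ T.InMovable x y z := fun h1 =>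
  h1.lt.not_ge h

theorem not_inMovable_root : ¬ T.InMovable x y T.root := by
  rintro ⟨m, hm, h⟩
  exact hm.1 (isDescendant_root_iff.1 h).symm

theorem exchangeParent_of_isMovable {z : V} (h : T.IsMovable x y z) :
    T.exchangeParent x y z = Equiv.swap x y (T.parent z) := if_pos h

theorem exchangeParent_of_not_isMovable {z : V} (h : ¬ T.IsMovable x y z) :
    T.exchangeParent x y z = T.parent z := if_neg h

theorem exchangeParent_of_not_inMovable {z : V} (h : ¬ T.InMovable x y z) :
    T.exchangeParent x y z = T.parent z :=
  exchangeParent_of_not_isMovable fun h1 => h h1.inMovable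

theorem IsMovable.exchangeParent_eq {z : V} (h : T.IsMovable x y z) :
    T.exchangeParent x y z = x ∨ T.exchangeParent x y z = y := by
  rw [exchangeParent_of_isMovable h]
  rcases h.2.1 with h1 | h1 <;> simp [h1]

theorem iterate_exchangeParent {z : V} (h : ¬ T.InMovable x y z) (j : ℕ) :
    (T.exchangeParent x y)^[j] z = T.parent^[j] z := by
  induction j generalizing z with
  | zero => rfl
  | succ j ih =>
    rw [Function.iterate_succ_apply, Function.iterate_succ_apply,
      exchangeParent_of_not_inMovable h,
      ih fun h1 => h (h1.of_isDescendant (T.isDescendant_parent z))]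

variable (T) in
/-- The tree obtained by exchanging the movable children of `x` with those of `y`. -/
noncomputable def exchange (h : x < y) : RootedLabeledTree V where
  root := T.root
  parent := T.exchangeParent x y
  parent_root := by
    rw [exchangeParent_of_not_inMovable not_inMovable_root, T.parent_root]
  exists_iterate_parent_eq_root z := by
    -- No cycle can arise: `x` and `y` are not larger than `y`, so they lie outside all movable
    -- subtrees and their paths to the root are unchanged.
    have key : ∀ z, ¬ T.InMovable x y z → ∃ j, (T.exchangeParent x y)^[j] z = T.root := by
      intro z hz
      obtain ⟨j, hj⟩ := T.exists_iterate_parent_eq_root z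
      exact ⟨j, by rw [iterate_exchangeParent hz, hj]⟩
    induction z using parent_induction (T := T) with
    | hroot => exact ⟨0, rfl⟩
    | hstep z hz ih =>
      have : ∃ j, (T.exchangeParent x y)^[j] (T.exchangeParent x y z) = T.root := by
        by_cases hm : T.IsMovable x y z
        · rcases hm.exchangeParent_eq with h1 | h1 <;> rw [h1]
          · exact key x (not_inMovable_of_le h.le)
          · exact key y (not_inMovable_of_le le_rfl)
        · rwa [exchangeParent_of_not_isMovable hm]
      obtain ⟨j, hj⟩ := this
      exact ⟨j + 1, hj⟩

variable (h : x < y)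

theorem exchange_root : (T.exchange h).root = T.root := rfl

theorem exchange_parent (z : V) : (T.exchange h).parent z = T.exchangeParent x y z := rfl

theorem exchange_isDescendant_of_not_inMovable {z w : V} (hz : ¬ T.InMovable x y z) :
    (T.exchange h).IsDescendant z w ↔ T.IsDescendant z w :=
  exists_congr fun j => by rw [← iterate_exchangeParent hz j]; rfl

theorem exchange_isDescendant_of_inMovable {z w : V} (hw : T.InMovable x y w) :
    (T.exchange h).IsDescendant z w ↔ T.IsDescendant z w := by
  induction z using parent_induction (T := T) with
  | hroot => exact exchange_isDescendant_of_not_inMovable h not_inMovable_root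
  | hstep z hz ih =>
    rw [isDescendant_iff, isDescendant_iff (T := T), exchange_parent]
    by_cases hm : T.IsMovable x y z
    · have key : ∀ v, v = x ∨ v = y → ¬ T.InMovable x y v := by
        rintro v (rfl | rfl)
        · exact not_inMovable_of_le h.le
        · exact not_inMovable_of_le le_rfl
      have h1 := key _ hm.2.1
      have h2 := key _ hm.exchangeParent_eq
      rw [exchange_isDescendant_of_not_inMovable h h2]
      exact or_congr_right (iff_of_false (fun h3 => h2 (hw.of_isDescendant h3))
        fun h3 => h1 (hw.of_isDescendant h3))
    · rw [exchangeParent_of_not_isMovable hm, ih]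

theorem InMovable.isDescendant_or {z w : V} (hz : T.InMovable x y z) (hw : ¬ T.InMovable x y w)
    (hzw : T.IsDescendant z w) : T.IsDescendant x w ∨ T.IsDescendant y w := by
  obtain ⟨m, hm, hzm⟩ := hz
  rcases IsDescendant.total T hzm hzw with h1 | h1
  · have h2 := h1.parent_of_ne fun h3 => hw (h3 ▸ hm.inMovable)
    rcases hm.2.1 with h3 | h3 <;> rw [h3] at h2
    exacts [Or.inl h2, Or.inr h2]
  · exact absurd ⟨m, hm, h1⟩ hw

theorem InMovable.isDescendant_or_of_exchange {z w : V} (hz : T.InMovable x y z)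
    (hw : ¬ T.InMovable x y w) (hzw : (T.exchange h).IsDescendant z w) :
    T.IsDescendant x w ∨ T.IsDescendant y w := by
  obtain ⟨m, hm, hzm⟩ := hz
  have hzm' := (exchange_isDescendant_of_inMovable h hm.inMovable).2 hzm
  rcases IsDescendant.total _ hzm' hzw with h1 | h1
  · have h2 := h1.parent_of_ne fun h3 => hw (h3 ▸ hm.inMovable)
    rw [exchange_parent] at h2
    refine hm.exchangeParent_eq.imp (fun h3 => ?_) fun h3 => ?_ <;> rw [h3] at h2
    · exact (exchange_isDescendant_of_not_inMovable h (not_inMovable_of_le h.le)).1 h2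
    · exact (exchange_isDescendant_of_not_inMovable h (not_inMovable_of_le le_rfl)).1 h2
  · exact absurd ⟨m, hm, (exchange_isDescendant_of_inMovable h hm.inMovable).1 h1⟩ hw

/-- Only nodes larger than `y` move, and if one of them is below a node `w` outside the movable
subtrees, then so is `x` or `y`, before and after. An upward closed condition already holds at the
moved node once it holds at `x` or `y`. In particular, lower bounds for subtrees, and with them
properness, are insensitive to the exchange. -/
theorem exchange_forall_iff {P : V → Prop} (hP : ∀ a b, a < b → P a → P b) {w : V} :
    (∀ z, (T.exchange h).IsDescendant z w → P z) ↔ ∀ z, T.IsDescendant z w → P z := by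
  by_cases hw : T.InMovable x y w
  · simp only [exchange_isDescendant_of_inMovable h hw]
  · have hx : ¬ T.InMovable x y x := not_inMovable_of_le h.le
    have hy : ¬ T.InMovable x y y := not_inMovable_of_le le_rfl
    constructor <;> intro hb z hz <;> by_cases hzu : T.InMovable x y z
    · rcases hzu.isDescendant_or hw hz with h1 | h1
      · exact hP _ _ (h.trans hzu.lt)
          (hb x ((exchange_isDescendant_of_not_inMovable h hx).2 h1))
      · exact hP _ _ hzu.lt (hb y ((exchange_isDescendant_of_not_inMovable h hy).2 h1))
    · exact hb z ((exchange_isDescendant_of_not_inMovable h hzu).2 hz)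
    · rcases hzu.isDescendant_or_of_exchange h hw hz with h1 | h1
      · exact hP _ _ (h.trans hzu.lt) (hb x h1)
      · exact hP _ _ hzu.lt (hb y h1)
    · exact hb z ((exchange_isDescendant_of_not_inMovable h hzu).1 hz)

theorem exchange_forall_lt_iff {w b : V} :
    (∀ z, (T.exchange h).IsDescendant z w → b < z) ↔ ∀ z, T.IsDescendant z w → b < z :=
  exchange_forall_iff h fun _ _ h1 h2 => h2.trans h1

theorem exchange_isMovable {z : V} :
    (T.exchange h).IsMovable x y z ↔ T.IsMovable x y z := by
  by_cases hz : T.IsMovable x y z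
  · refine iff_of_true ⟨hz.1, hz.exchangeParent_eq, ?_⟩ hz
    exact (exchange_forall_lt_iff h).2 hz.2.2
  · rw [IsMovable, exchange_forall_lt_iff, exchange_root, exchange_parent,
      exchangeParent_of_not_isMovable hz, IsMovable]

theorem exchange_exchange : (T.exchange h).exchange h = T := by
  ext z
  · rfl
  · rw [exchange_parent]
    by_cases hz : T.IsMovable x y z
    · rw [exchangeParent_of_isMovable ((exchange_isMovable h).2 hz), exchange_parent,
        exchangeParent_of_isMovable hz, Equiv.swap_apply_self]
    · rw [exchangeParent_of_not_isMovable (mt (exchange_isMovable h).1 hz), exchange_parent,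
        exchangeParent_of_not_isMovable hz]

variable [Fintype V]

theorem IsMovable.isProper {z : V} (h : x < y) (hz : T.IsMovable x y z) : T.IsProper z := by
  refine isProper_iff.2 ⟨hz.1, fun w hw => ?_⟩
  rcases hz.2.1 with h1 | h1 <;> rw [h1]
  · exact h.trans (hz.2.2 w hw)
  · exact hz.2.2 w hw

theorem exchange_isProper {z : V} : (T.exchange h).IsProper z ↔ T.IsProper z := by
  by_cases hz : T.IsMovable x y z
  · exact iff_of_true (((exchange_isMovable h).2 hz).isProper h) (hz.isProper h)
  · rw [isProper_iff, isProper_iff, exchange_forall_lt_iff, exchange_root, exchange_parent,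
      exchangeParent_of_not_isMovable hz]

theorem exchange_numImproper : (T.exchange h).numImproper = T.numImproper := by
  simp only [numImproper_eq_ncard, isImproper_iff, exchange_isProper, exchange_root]

theorem exchange_deg {v : V} (hx : v ≠ x) (hy : v ≠ y) : (T.exchange h).deg v = T.deg v := by
  simp only [deg_eq_ncard, exchange_root, exchange_parent]
  congr 1
  ext z
  by_cases hz : T.IsMovable x y z
  · refine and_congr_right fun _ => iff_of_false ?_ ?_
    · rcases hz.exchangeParent_eq with h1 | h1 <;> rw [h1]
      exacts [hx.symm, hy.symm]
    · rcases hz.2.1 with h1 | h1 <;> rw [h1]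
      exacts [hx.symm, hy.symm]
  · rw [Set.mem_ofPred_eq, exchangeParent_of_not_isMovable hz]
    rfl

end Exchange

end RootedLabeledTree

namespace RootedLabeledTree

/-! ### Permuting the labels. -/

section Relabel

variable {V : Type*} (T : RootedLabeledTree V) (e : Equiv.Perm V)

theorem iterate_conj (j : ℕ) (z : V) :
    (fun z => e (T.parent (e.symm z)))^[j] (e z) = e (T.parent^[j] z) := by
  induction j generalizing z with
  | zero => rfl
  | succ j ih => simp only [Function.iterate_succ_apply, Equiv.symm_apply_apply, ih]

/-- The tree obtained by applying a permutation to the labels. -/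
def relabel : RootedLabeledTree V where
  root := e T.root
  parent z := e (T.parent (e.symm z))
  parent_root := by rw [Equiv.symm_apply_apply, T.parent_root]
  exists_iterate_parent_eq_root z := by
    obtain ⟨j, hj⟩ := T.exists_iterate_parent_eq_root (e.symm z)
    exact ⟨j, by rw [← hj, ← iterate_conj, Equiv.apply_symm_apply]⟩

variable {T e}

theorem relabel_root : (T.relabel e).root = e T.root := rfl

theorem relabel_parent (z : V) : (T.relabel e).parent (e z) = e (T.parent z) := by
  simp [relabel]

theorem relabel_isDescendant {z w : V} :
    (T.relabel e).IsDescendant (e z) (e w) ↔ T.IsDescendant z w :=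
  exists_congr fun j => by
    rw [← e.apply_eq_iff_eq (x := T.parent^[j] z), ← iterate_conj]
    rfl

theorem relabel_relabel (he : ∀ z, e (e z) = z) : (T.relabel e).relabel e = T := by
  have hs : ∀ z, e.symm z = e z := fun z => by rw [Equiv.symm_apply_eq, he]
  ext z <;> simp [relabel, he, hs]

theorem relabel_deg [Fintype V] [LinearOrder V] (x : V) :
    (T.relabel e).deg (e x) = T.deg x := by
  rw [deg_eq_ncard, deg_eq_ncard]
  refine Eq.trans (congrArg Set.ncard ?_) (Set.ncard_image_of_injective _ e.injective)
  ext z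
  obtain ⟨z, rfl⟩ := e.surjective z
  simp [relabel_parent, relabel_root]

section Proper

variable [Fintype V] [LinearOrder V]

theorem relabel_numImproper
    (hp : ∀ z, (T.relabel e).IsProper (e z) ↔ T.IsProper z) :
    (T.relabel e).numImproper = T.numImproper := by
  rw [numImproper_eq_ncard, numImproper_eq_ncard]
  refine Eq.trans (congrArg Set.ncard ?_) (Set.ncard_image_of_injective _ e.injective)
  ext z
  obtain ⟨z, rfl⟩ := e.surjective z
  simp [isImproper_iff, hp, relabel_root]

theorem relabel_numProperNear
    (hp : ∀ z, (T.relabel e).IsProper (e z) ↔ T.IsProper z)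
    (x : V) :
    (T.relabel e).numProperNear (e x) = T.numProperNear x := by
  rw [numProperNear, numProperNear]
  refine Eq.trans (congrArg Set.ncard ?_) (Set.ncard_image_of_injective _ e.injective)
  ext z
  obtain ⟨z, rfl⟩ := e.surjective z
  simp [hp, relabel_parent, relabel_isDescendant]

end Proper

end Relabel

/-! ### Passing from a label to its successor. -/

section Transpose

variable {V : Type*} [LinearOrder V] {x y : V}

theorem swap_lt_swap_iff (h : x ⋖ y) {a b : V} (h1 : ¬ (a = x ∧ b = y)) (h2 : ¬ (a = y ∧ b = x)) :
    Equiv.swap x y a < Equiv.swap x y b ↔ a < b := by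
  have hl : ∀ c, c ≠ x → c ≠ y → (c < x ↔ c < y) := fun c hx _ =>
    ⟨fun hc => hc.trans h.lt, fun hc => lt_of_le_of_ne (not_lt.1 fun h3 => h.2 h3 hc) hx⟩
  have hr : ∀ c, c ≠ x → c ≠ y → (x < c ↔ y < c) := fun c _ hy =>
    ⟨fun hc => lt_of_le_of_ne (not_lt.1 fun h3 => h.2 hc h3) hy.symm, fun hc => h.lt.trans hc⟩
  by_cases hax : a = x <;> by_cases hay : a = y <;> by_cases hbx : b = x <;>
    by_cases hby : b = y <;>
    simp_all [Equiv.swap_apply_of_ne_of_ne]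

variable (T : RootedLabeledTree V)

/-- The tree has an edge whose status changes when the labels `x < y` are transposed. -/
def IsCritical (x y : V) : Prop :=
  ∃ c, c ≠ T.root ∧
    (T.parent c = x ∧ T.IsDescendant y c ∨ T.parent c = y ∧ T.IsDescendant x c) ∧
    ∀ z, T.IsDescendant z c → x ≤ z

variable {T}

theorem le_swap_iff (h : x < y) {z : V} : x ≤ Equiv.swap x y z ↔ x ≤ z := by
  by_cases hx : z = x
  · simp [hx, h.le]
  · by_cases hy : z = y
    · simp [hy, h.le]
    · rw [Equiv.swap_apply_of_ne_of_ne hx hy]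

/-- Transposing the labels turns the two kinds of critical edge into each other. Criticality is thus
invariant, which makes the case distinction in `transpose` an involution. -/
theorem isCritical_relabel_of (h : x < y) (hT : T.IsCritical x y) :
    (T.relabel (Equiv.swap x y)).IsCritical x y := by
  obtain ⟨c, hc, hor, hle⟩ := hT
  refine ⟨Equiv.swap x y c, ?_, ?_, fun z hz => ?_⟩
  · rwa [relabel_root, (Equiv.injective _).ne_iff]
  · rw [relabel_parent]
    refine hor.symm.imp (fun h1 => ⟨by simp [h1.1], ?_⟩) fun h1 => ⟨by simp [h1.1], ?_⟩
    · simpa using (relabel_isDescendant (e := Equiv.swap x y)).2 h1.2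
    · simpa using (relabel_isDescendant (e := Equiv.swap x y)).2 h1.2
  · obtain ⟨z, rfl⟩ := (Equiv.swap x y).surjective z
    rw [le_swap_iff h]
    exact hle z (relabel_isDescendant.1 hz)

theorem isCritical_relabel (h : x < y) :
    (T.relabel (Equiv.swap x y)).IsCritical x y ↔ T.IsCritical x y := by
  refine ⟨fun h1 => ?_, isCritical_relabel_of h⟩
  rw [← relabel_relabel (T := T) (e := Equiv.swap x y) (Equiv.swap_apply_self x y)]
  exact isCritical_relabel_of h h1

/-- The subtree below a critical edge contains `x` or `y`, so its top node is not movable and the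
edge stays in place. -/
theorem isCritical_exchange_of (h : x < y) (hT : T.IsCritical x y) :
    (T.exchange h).IsCritical x y := by
  obtain ⟨c, hc, hor, hle⟩ := hT
  have hx : ¬ T.InMovable x y x := not_inMovable_of_le h.le
  have hy : ¬ T.InMovable x y y := not_inMovable_of_le le_rfl
  have hm : ¬ T.IsMovable x y c := fun hm => by
    rcases hor with h1 | h1
    · exact lt_irrefl _ (hm.2.2 _ h1.2)
    · exact lt_asymm h (hm.2.2 _ h1.2)
  refine ⟨c, hc, ?_, (exchange_forall_iff h fun _ _ h1 h2 => h2.trans h1.le).2 hle⟩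
  rw [exchange_parent, exchangeParent_of_not_isMovable hm,
    exchange_isDescendant_of_not_inMovable h hx, exchange_isDescendant_of_not_inMovable h hy]
  exact hor

theorem isCritical_exchange (h : x < y) : (T.exchange h).IsCritical x y ↔ T.IsCritical x y := by
  refine ⟨fun h1 => ?_, isCritical_exchange_of h⟩
  rw [← exchange_exchange (T := T) h]
  exact isCritical_exchange_of h h1

/-- As `x` and `y` are adjacent, the swap only alters the comparison of `x` with `y`. An edge making
this comparison can change status only if all other nodes of its subtree exceed both labels, that
is, if it is critical. -/
theorem relabel_isProper_of_not_isCritical [Fintype V] (h : x ⋖ y) (hT : ¬ T.IsCritical x y)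
    (c : V) : (T.relabel (Equiv.swap x y)).IsProper (Equiv.swap x y c) ↔ T.IsProper c := by
  rw [isProper_iff, isProper_iff, relabel_root, (Equiv.injective _).ne_iff, relabel_parent]
  refine and_congr_right fun hc => ?_
  rw [← (Equiv.swap x y).forall_congr_right]
  simp only [relabel_isDescendant]
  by_cases h1 : T.parent c = x ∧ T.IsDescendant y c
  · refine iff_of_false (fun h2 => ?_) fun h2 => ?_
    · have h3 := h2 y h1.2
      rw [h1.1, Equiv.swap_apply_left, Equiv.swap_apply_right] at h3
      exact lt_asymm h.lt h3
    · exact hT ⟨c, hc, Or.inl h1, fun z hz => h1.1 ▸ (h2 z hz).le⟩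
  · by_cases h2 : T.parent c = y ∧ T.IsDescendant x c
    · refine iff_of_false (fun h3 => ?_) fun h3 => ?_
      · refine hT ⟨c, hc, Or.inr h2, fun z hz => ?_⟩
        have h4 := h3 z hz
        rw [h2.1, Equiv.swap_apply_right] at h4
        exact (le_swap_iff h.lt).1 h4.le
      · exact lt_asymm h.lt (h2.1 ▸ h3 x h2.2)
    · refine forall₂_congr fun z hz => swap_lt_swap_iff h ?_ ?_
      · rintro ⟨h3, rfl⟩
        exact h1 ⟨h3, hz⟩
      · rintro ⟨h3, rfl⟩
        exact h2 ⟨h3, hz⟩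

/-- For movable `z` the exchange of fathers is exactly the claim. A proper edge that is not movable
cannot have father `y`, and if its father is `x` then `y` lies below it. What remains is to compare
the ancestors of `x` and `y`, which the critical edge makes comparable. -/
theorem IsProper.isDescendant_or_exchange_parent_iff [Fintype V] (h : x ⋖ y)
    (hT : T.IsCritical x y) {z : V} (hz : T.IsProper z) :
    T.IsDescendant y z ∨ (T.exchange h.lt).parent z = y ↔
      T.IsDescendant x z ∨ T.parent z = x := by
  rw [exchange_parent]
  by_cases hm : T.IsMovable x y z
  · rw [exchangeParent_of_isMovable hm]
    have hx : ¬ T.IsDescendant x z := fun h1 => lt_asymm h.lt (hm.2.2 x h1)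
    have hy : ¬ T.IsDescendant y z := fun h1 => lt_irrefl _ (hm.2.2 y h1)
    simp only [hx, hy, false_or]
    rw [Equiv.swap_apply_eq_iff, Equiv.swap_apply_right]
  · rw [exchangeParent_of_not_isMovable hm]
    have hpy : T.parent z ≠ y := fun h1 =>
      hm ⟨hz.1, Or.inr h1, fun w hw => h1 ▸ hz.parent_lt hw⟩
    have hpx : T.parent z = x → T.IsDescendant y z := by
      intro h1
      by_contra hy
      refine hm ⟨hz.1, Or.inl h1, fun w hw => lt_of_le_of_ne (not_lt.1 fun h2 => ?_) ?_⟩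
      · exact h.2 (h1 ▸ hz.parent_lt hw) h2
      · rintro rfl
        exact hy hw
    simp only [hpy, or_false]
    obtain ⟨c, hc, ⟨hcx, hyc⟩ | ⟨hcy, hxc⟩, hle⟩ := hT
    · have hxy : T.IsDescendant y x :=
        IsDescendant.trans T hyc (hcx ▸ T.isDescendant_parent c)
      refine ⟨fun hyz => ?_, fun h1 => h1.elim (IsDescendant.trans T hxy) hpx⟩
      rcases eq_or_ne c z with rfl | hne
      · exact Or.inr hcx
      rcases IsDescendant.total T hyc hyz with h1 | h1
      · exact Or.inl (hcx ▸ h1.parent_of_ne hne)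
      -- Here the father of `z` lies in `T_c`, so it is at least `x`, and it is less than `y` by
      -- properness; adjacency leaves only `x`.
      · have h2 := hle _ (h1.parent_of_ne hne.symm)
        refine Or.inr (le_antisymm (not_lt.1 fun h3 => h.2 h3 (hz.parent_lt hyz)) h2)
    · have hxy : T.IsDescendant x y :=
        IsDescendant.trans T hxc (hcy ▸ T.isDescendant_parent c)
      refine ⟨fun hyz => Or.inl (IsDescendant.trans T hxy hyz), fun h1 => h1.elim ?_ hpx⟩
      intro hxz
      have hne : c ≠ z := by
        rintro rfl
        exact hpy hcy
      rcases IsDescendant.total T hxc hxz with h1 | h1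
      · exact hcy ▸ h1.parent_of_ne hne
      · exact absurd (hz.parent_lt hxz) (hle _ (h1.parent_of_ne hne.symm)).not_gt

theorem exchange_numProperNear_of_isCritical [Fintype V] (h : x ⋖ y) (hT : T.IsCritical x y) :
    (T.exchange h.lt).numProperNear y = T.numProperNear x := by
  rw [numProperNear, numProperNear]
  congr 1
  ext z
  simp only [Set.mem_ofPred_eq, exchange_isProper,
    exchange_isDescendant_of_not_inMovable h.lt (not_inMovable_of_le le_rfl)]
  exact and_congr_right fun hz => hz.isDescendant_or_exchange_parent_iff h hT

open Classical in
/-- Transpose the labels `x` and `y` if this affects no edge, otherwise exchange the movable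
children of `x` and `y`. -/
noncomputable def transpose (h : x ⋖ y) (T : RootedLabeledTree V) : RootedLabeledTree V :=
  if T.IsCritical x y then T.exchange h.lt else T.relabel (Equiv.swap x y)

theorem transpose_involutive (h : x ⋖ y) : Function.Involutive (transpose h) := by
  intro T
  by_cases hT : T.IsCritical x y
  · rw [transpose, transpose, if_pos hT, if_pos ((isCritical_exchange h.lt).2 hT),
      exchange_exchange]
  · rw [transpose, transpose, if_neg hT, if_neg (mt (isCritical_relabel h.lt).1 hT),
      relabel_relabel (Equiv.swap_apply_self x y)]

variable [Fintype V]

theorem transpose_numImproper (h : x ⋖ y) : (T.transpose h).numImproper = T.numImproper := by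
  by_cases hT : T.IsCritical x y
  · rw [transpose, if_pos hT, exchange_numImproper]
  · rw [transpose, if_neg hT, relabel_numImproper (relabel_isProper_of_not_isCritical h hT)]

theorem transpose_numProperNear (h : x ⋖ y) :
    (T.transpose h).numProperNear y = T.numProperNear x := by
  by_cases hT : T.IsCritical x y
  · rw [transpose, if_pos hT, exchange_numProperNear_of_isCritical h hT]
  · rw [transpose, if_neg hT,
      ← relabel_numProperNear (relabel_isProper_of_not_isCritical h hT) x, Equiv.swap_apply_left]

theorem transpose_deg (h : x ⋖ y) {v : V} (hx : v ≠ x) (hy : v ≠ y) :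
    (T.transpose h).deg v = T.deg v := by
  by_cases hT : T.IsCritical x y
  · rw [transpose, if_pos hT, exchange_deg h.lt hx hy]
  · rw [transpose, if_neg hT, ← relabel_deg (T := T) (e := Equiv.swap x y) v,
      Equiv.swap_apply_of_ne_of_ne hx hy]

theorem exists_perm_numProperNear [SuccOrder V] [IsSuccArchimedean V] [OrderBot V] {u x : V}
    (hu : ⊥ < u) (hux : u ≤ x) :
    ∃ σ : Equiv.Perm (RootedLabeledTree V), ∀ T : RootedLabeledTree V,
      (σ T).numImproper = T.numImproper ∧ (σ T).deg ⊥ = T.deg ⊥ ∧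
        (σ T).numProperNear x = T.numProperNear u := by
  induction hux using Succ.rec with
  | rfl => exact ⟨1, fun T => ⟨rfl, rfl, rfl⟩⟩
  | succ x hux ih =>
    obtain ⟨σ, hσ⟩ := ih
    -- The successor of a maximal element is the element itself, so there is nothing to do.
    by_cases hmax : IsMax x
    · rw [Order.succ_eq_iff_isMax.2 hmax]
      exact ⟨σ, hσ⟩
    · have hcov := Order.covBy_succ_of_not_isMax hmax
      have hx : ⊥ < x := hu.trans_le hux
      refine ⟨σ.trans (transpose_involutive hcov).toPerm, fun T => ?_⟩
      obtain ⟨h1, h2, h3⟩ := hσ T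
      simp only [Equiv.trans_apply, Function.Involutive.coe_toPerm]
      exact ⟨(transpose_numImproper hcov).trans h1,
        (transpose_deg hcov hx.ne (hx.trans hcov.lt).ne).trans h2,
        (transpose_numProperNear hcov).trans h3⟩

end Transpose

end RootedLabeledTree

/-! ### The two smallest labels. -/

namespace RootedLabeledTree

variable {V : Type*} [LinearOrder V] [OrderBot V] {T : RootedLabeledTree V} {y : V}

theorem isMovable_bot_of_parent_eq_bot (h : ⊥ ⋖ y) (hy : ¬ T.IsDescendant y ⊥) {z : V}
    (hz : z ≠ T.root) (hzb : T.parent z = ⊥) : T.IsMovable ⊥ y z := by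
  refine ⟨hz, Or.inl hzb, fun w hw => ?_⟩
  have hw0 : w ≠ ⊥ := by
    rintro rfl
    exact not_isDescendant_parent hz (hzb ▸ hw)
  refine lt_of_le_of_ne (not_lt.1 fun h1 => h.2 (bot_lt_iff_ne_bot.2 hw0) h1) ?_
  rintro rfl
  exact hy (IsDescendant.trans T hw (hzb ▸ T.isDescendant_parent z))

variable [Fintype V]

theorem deg_bot_eq_ncard_isMovable (h : ⊥ ⋖ y) (hy : ¬ T.IsDescendant y ⊥) :
    T.deg ⊥ = {z | T.IsMovable ⊥ y z ∧ T.parent z = ⊥}.ncard := by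
  rw [deg_eq_ncard]
  congr 1
  ext z
  exact ⟨fun hz => ⟨isMovable_bot_of_parent_eq_bot h hy hz.1 hz.2, hz.2⟩,
    fun hz => ⟨hz.1.1, hz.2⟩⟩

/-- A proper edge above `y` has a father smaller than `y`, hence `⊥`, which is excluded by
assumption. Only proper edges with father `y` remain, and these are the movable ones. -/
theorem numProperNear_eq_ncard_isMovable (h : ⊥ ⋖ y) (hy : ¬ T.IsDescendant y ⊥) :
    T.numProperNear y = {z | T.IsMovable ⊥ y z ∧ T.parent z = y}.ncard := by
  rw [numProperNear]
  congr 1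
  ext z
  refine ⟨fun ⟨hz, hor⟩ => ?_, fun hz => ⟨hz.1.isProper h.lt, Or.inr hz.2⟩⟩
  rcases hor with h1 | h1
  · have h2 : T.parent z = ⊥ := by
      by_contra h3
      exact h.2 (bot_lt_iff_ne_bot.2 h3) (hz.parent_lt h1)
    exact absurd (IsDescendant.trans T h1 (h2 ▸ T.isDescendant_parent z)) hy
  · exact ⟨⟨hz.1, Or.inr h1, fun w hw => h1 ▸ hz.parent_lt hw⟩, h1⟩

theorem exchange_deg_bot (h : ⊥ ⋖ y) (hy : ¬ T.IsDescendant y ⊥) :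
    (T.exchange h.lt).deg ⊥ = T.numProperNear y := by
  have hy' : ¬ (T.exchange h.lt).IsDescendant y ⊥ := by
    rwa [exchange_isDescendant_of_not_inMovable h.lt (not_inMovable_of_le le_rfl)]
  rw [deg_bot_eq_ncard_isMovable h hy', numProperNear_eq_ncard_isMovable h hy]
  congr 1
  ext z
  simp only [Set.mem_ofPred_eq, exchange_isMovable, exchange_parent]
  refine and_congr_right fun hz => ?_
  rw [exchangeParent_of_isMovable hz, Equiv.swap_apply_eq_iff, Equiv.swap_apply_left]

/-- If `y` were below `⊥`, the edge from `⊥` towards `y` would contribute to both numbers, since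
every edge with father `⊥` is proper. -/
theorem not_isDescendant_bot_of_eq_zero (h : ⊥ ⋖ y)
    (hT : T.numProperNear y = 0 ∨ T.deg ⊥ = 0) : ¬ T.IsDescendant y ⊥ := by
  intro hy
  obtain ⟨c, hc, hcb, hyc⟩ := hy.exists_child h.lt.ne'
  rcases hT with h1 | h1
  · refine h1.not_gt ?_
    rw [numProperNear, Set.ncard_pos]
    refine ⟨c, isProper_iff.2 ⟨hc, fun z hz => ?_⟩, Or.inl hyc⟩
    rw [hcb, bot_lt_iff_ne_bot]
    rintro rfl
    exact not_isDescendant_parent hc (hcb ▸ hz)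
  · exact (deg_pos_iff T |>.2 ⟨c, hc, hcb⟩).ne' h1

theorem exchange_numProperNear (h : ⊥ ⋖ y) (hy : ¬ T.IsDescendant y ⊥) :
    (T.exchange h.lt).numProperNear y = T.deg ⊥ := by
  have hy' : ¬ (T.exchange h.lt).IsDescendant y ⊥ := by
    rwa [exchange_isDescendant_of_not_inMovable h.lt (not_inMovable_of_le le_rfl)]
  rw [← exchange_deg_bot h hy', exchange_exchange]

open Classical in
/-- Exchange the movable children of `⊥` and its successor `y` if `deg ⊥` or the number of proper
edges near `y` vanishes. -/
noncomputable def exchangeBot (h : ⊥ ⋖ y) (T : RootedLabeledTree V) : RootedLabeledTree V :=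
  if T.numProperNear y = 0 ∨ T.deg ⊥ = 0 then T.exchange h.lt else T

theorem exchangeBot_involutive (h : ⊥ ⋖ y) : Function.Involutive (exchangeBot h) := by
  intro T
  by_cases hT : T.numProperNear y = 0 ∨ T.deg ⊥ = 0
  · have hy := not_isDescendant_bot_of_eq_zero h hT
    rw [exchangeBot, exchangeBot, if_pos hT, exchange_numProperNear h hy, exchange_deg_bot h hy,
      if_pos hT.symm, exchange_exchange]
  · rw [exchangeBot, exchangeBot, if_neg hT, if_neg hT]

variable (V) in
/-- A permutation of the trees that preserves the number of improper edges and interchanges the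
degree of `⊥` and the number of proper edges on the path from `⊤` to the root if one of these two
numbers is zero, and preserves both otherwise. -/
theorem exists_perm_swap_deg_bot [SuccOrder V] [IsSuccArchimedean V] [OrderTop V]
    (hV : (⊥ : V) ≠ ⊤) :
    ∃ τ : Equiv.Perm (RootedLabeledTree V), ∀ T : RootedLabeledTree V,
      (τ T).numImproper = T.numImproper ∧
      ((T.numProperOnPath ⊤ = 0 ∨ T.deg ⊥ = 0) →
        (τ T).deg ⊥ = T.numProperOnPath ⊤ ∧ (τ T).numProperOnPath ⊤ = T.deg ⊥) ∧
      (¬ (T.numProperOnPath ⊤ = 0 ∨ T.deg ⊥ = 0) →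
        (τ T).deg ⊥ = T.deg ⊥ ∧ (τ T).numProperOnPath ⊤ = T.numProperOnPath ⊤) := by
  have hmax : ¬ IsMax (⊥ : V) := fun h => hV (le_antisymm bot_le (h bot_le))
  have hcov := Order.covBy_succ_of_not_isMax hmax
  obtain ⟨σ, hσ⟩ := exists_perm_numProperNear hcov.lt (le_top : Order.succ (⊥ : V) ≤ ⊤)
  -- Conjugation by `σ` carries the exchange from the successor of `⊥` to `⊤`.
  refine ⟨(σ.symm.trans (exchangeBot_involutive hcov).toPerm).trans σ, fun T => ?_⟩
  obtain ⟨T, rfl⟩ := σ.surjective T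
  let : BoundedOrder V := { }
  obtain ⟨h1, h2, h3⟩ := hσ T
  simp only [numProperNear_top] at hσ h3
  simp only [Equiv.trans_apply, Equiv.symm_apply_apply, Function.Involutive.coe_toPerm]
  obtain ⟨g1, g2, g3⟩ := hσ (exchangeBot hcov T)
  rw [g1, g2, g3, h1, h2, h3]
  by_cases hT : T.numProperNear (Order.succ ⊥) = 0 ∨ T.deg ⊥ = 0
  · have hy := not_isDescendant_bot_of_eq_zero hcov hT
    rw [exchangeBot, if_pos hT]
    exact ⟨exchange_numImproper _,
      fun _ => ⟨exchange_deg_bot hcov hy, exchange_numProperNear hcov hy⟩, fun h => absurd hT h⟩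
  · rw [exchangeBot, if_neg hT]
    exact ⟨rfl, fun h => absurd h hT, fun _ => ⟨rfl, rfl⟩⟩

end RootedLabeledTree

namespace RootedLabeledTree

/-! ### Reversing a path. -/

section Reverse

variable {V : Type*} (T : RootedLabeledTree V)

/-- `z` lies on the path from `b` to its ancestor `a`. -/
def OnSegment (a b z : V) : Prop := T.IsDescendant b z ∧ T.IsDescendant z a

open Classical in
/-- The child of `z` that is an ancestor of `b`, if there is one. -/
noncomputable def childToward (b z : V) : V :=
  if h : ∃ w, w ≠ T.root ∧ T.parent w = z ∧ T.IsDescendant b w then h.choose else z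

open Classical in
/-- The father map after the path from `b` to its ancestor `a` has been reversed. -/
noncomputable def reverseParent (a b z : V) : V :=
  if T.OnSegment a b z then
    if z = b then if a = T.root then b else T.parent a
    else T.childToward b z
  else T.parent z

open Classical in
/-- The root after the path from `b` to its ancestor `a` has been reversed. -/
noncomputable def reverseRoot (a b : V) : V := if a = T.root then b else T.root

variable {T} {a b : V}

theorem childToward_parent {w : V} (hw : w ≠ T.root) (hb : T.IsDescendant b w) :
    T.childToward b (T.parent w) = w := by
  have h : ∃ v, v ≠ T.root ∧ T.parent v = T.parent w ∧ T.IsDescendant b v := ⟨w, hw, rfl, hb⟩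
  rw [childToward, dif_pos h]
  exact child_unique h.choose_spec.1 hw h.choose_spec.2.1 h.choose_spec.2.2 hb

theorem reverseRoot_of_eq (h : a = T.root) : T.reverseRoot a b = b := if_pos h

theorem reverseRoot_of_ne (h : a ≠ T.root) : T.reverseRoot a b = T.root := if_neg h

theorem reverseParent_of_not_onSegment {z : V} (h : ¬ T.OnSegment a b z) :
    T.reverseParent a b z = T.parent z := if_neg h

theorem reverseParent_bottom_of_eq (h : a = T.root) : T.reverseParent a b b = b := by
  rw [reverseParent, if_pos ⟨T.isDescendant_refl b, h ▸ T.isDescendant_root b⟩, if_pos rfl,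
    if_pos h]

theorem reverseParent_bottom_of_ne (hab : T.IsDescendant b a) (h : a ≠ T.root) :
    T.reverseParent a b b = T.parent a := by
  rw [reverseParent, if_pos ⟨T.isDescendant_refl b, hab⟩, if_pos rfl, if_neg h]

theorem reverseParent_parent {w : V} (hw : w ≠ T.root) (hb : T.IsDescendant b w)
    (ha : T.IsDescendant (T.parent w) a) : T.reverseParent a b (T.parent w) = w := by
  have hne : T.parent w ≠ b := by
    rintro rfl
    exact not_isDescendant_parent hw hb
  rw [reverseParent, if_pos ⟨IsDescendant.trans T hb (T.isDescendant_parent w), ha⟩, if_neg hne,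
    childToward_parent hw hb]

theorem OnSegment.exists_child {z : V} (h : T.OnSegment a b z) (hz : z ≠ b) :
    ∃ u, u ≠ T.root ∧ T.parent u = z ∧ T.OnSegment a b u ∧ T.reverseParent a b z = u := by
  obtain ⟨u, hu, rfl, hbu⟩ := h.1.exists_child hz.symm
  exact ⟨u, hu, rfl, ⟨hbu, IsDescendant.trans T (T.isDescendant_parent u) h.2⟩,
    reverseParent_parent hu hbu h.2⟩

theorem ne_root_of_not_isDescendant {z : V} (hz : ¬ T.IsDescendant z a) : a ≠ T.root := fun h =>
  hz (h ▸ T.isDescendant_root z)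

theorem OnSegment.isDescendant_iff_of_not_onSegment {z w : V} (hz : T.OnSegment a b z)
    (hw : ¬ T.OnSegment a b w) : T.IsDescendant z w ↔ T.IsDescendant a w := by
  refine ⟨fun h => ?_, IsDescendant.trans T hz.2⟩
  rcases IsDescendant.total T hz.2 h with h1 | h1
  · exact h1
  · exact absurd ⟨IsDescendant.trans T hz.1 h, h1⟩ hw

/-- A path now runs down the segment to `b` and continues from the old father of `a`, outside `T_a`,
where nothing has changed; if `a` was the root, it stops at `b`. -/
theorem exists_iterate_reverseParent (hab : T.IsDescendant b a) (z : V) :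
    ∃ j, (T.reverseParent a b)^[j] z = T.reverseRoot a b := by
  have step : ∀ z, (∃ j, (T.reverseParent a b)^[j] (T.reverseParent a b z) = T.reverseRoot a b) →
      ∃ j, (T.reverseParent a b)^[j] z = T.reverseRoot a b := fun z ⟨j, hj⟩ => ⟨j + 1, hj⟩
  have outside : ∀ z, ¬ T.IsDescendant z a →
      ∃ j, (T.reverseParent a b)^[j] z = T.reverseRoot a b := by
    intro z hz
    induction z using parent_induction (T := T) with
    | hroot => exact ⟨0, (reverseRoot_of_ne (ne_root_of_not_isDescendant hz)).symm⟩
    | hstep z _ ih =>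
      apply step
      rw [reverseParent_of_not_onSegment fun h => hz h.2]
      exact ih fun h => hz (IsDescendant.trans T (T.isDescendant_parent z) h)
  have segment : ∀ j z, T.parent^[j] b = z → T.IsDescendant z a →
      ∃ j, (T.reverseParent a b)^[j] z = T.reverseRoot a b := by
    intro j
    induction j with
    | zero =>
      rintro z rfl _
      by_cases ha : a = T.root
      · exact ⟨0, (reverseRoot_of_eq ha).symm⟩
      · apply step
        rw [Function.iterate_zero_apply, reverseParent_bottom_of_ne hab ha]
        exact outside _ (not_isDescendant_parent ha)
    | succ j ih =>
      rintro z rfl hz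
      rw [Function.iterate_succ_apply'] at hz ⊢
      have hw := IsDescendant.trans T (T.isDescendant_parent _) hz
      by_cases hr : T.parent^[j] b = T.root
      · rw [hr, T.parent_root]
        exact ih _ hr (hr ▸ hw)
      · apply step
        rw [reverseParent_parent hr ⟨j, rfl⟩ hz]
        exact ih _ rfl hw
  induction z using parent_induction (T := T) with
  | hroot =>
    by_cases h : T.IsDescendant T.root a
    · obtain ⟨j, hj⟩ := T.isDescendant_root b
      exact segment j _ hj h
    · exact outside _ h
  | hstep z _ ih =>
    by_cases h : T.OnSegment a b z
    · obtain ⟨j, hj⟩ := h.1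
      exact segment j _ hj h.2
    · apply step
      rwa [reverseParent_of_not_onSegment h]

/-- The tree obtained by reversing the path from `b` to its ancestor `a`: the node `b` takes the
place of `a`, and the edges of the path are reversed. -/
noncomputable def reverse (hab : T.IsDescendant b a) : RootedLabeledTree V where
  root := T.reverseRoot a b
  parent := T.reverseParent a b
  parent_root := by
    by_cases h : a = T.root
    · rw [reverseRoot_of_eq h, reverseParent_bottom_of_eq h]
    · rw [reverseRoot_of_ne h, reverseParent_of_not_onSegment, T.parent_root]
      exact fun h1 => h (isDescendant_root_iff.1 h1.2).symm
  exists_iterate_parent_eq_root := exists_iterate_reverseParent hab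

theorem reverse_root (hab : T.IsDescendant b a) : (reverse hab).root = T.reverseRoot a b := rfl

theorem reverse_parent (hab : T.IsDescendant b a) (z : V) :
    (reverse hab).parent z = T.reverseParent a b z := rfl

theorem reverse_congr {a a' b b' : V} (h : T.IsDescendant b a) (h' : T.IsDescendant b' a')
    (ha : a = a') (hb : b = b') : reverse h = reverse h' := by
  subst ha hb
  rfl

variable (hab : T.IsDescendant b a)

theorem reverse_isDescendant_of_not_onSegment {w : V} (hw : ¬ T.OnSegment a b w) (z : V) :
    (reverse hab).IsDescendant z w ↔ T.IsDescendant z w := by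
  have hseg_b : T.OnSegment a b b := ⟨T.isDescendant_refl b, hab⟩
  have hseg_a : T.OnSegment a b a := ⟨hab, T.isDescendant_refl a⟩
  refine isDescendant_iff_of_rec (D := fun z => T.IsDescendant z w) ?_ (fun z hz => ?_) z
  · rw [reverse_root]
    by_cases ha : a = T.root
    · rw [reverseRoot_of_eq ha]
      refine iff_of_false (fun h => hw ⟨h, ha ▸ T.isDescendant_root w⟩) ?_
      rintro rfl
      exact hw hseg_b
    · rw [reverseRoot_of_ne ha, isDescendant_root_iff]
  · rw [reverse_parent]
    by_cases hs : T.OnSegment a b z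
    · have hne : ∀ {v}, T.OnSegment a b v → v ≠ w := by
        rintro v hv rfl
        exact hw hv
      rw [or_iff_right (hne hs), hs.isDescendant_iff_of_not_onSegment hw]
      by_cases hzb : z = b
      · subst hzb
        have ha : a ≠ T.root := fun h => hz (reverseRoot_of_eq h).symm
        rw [reverseParent_bottom_of_ne hab ha, isDescendant_iff, or_iff_right (hne hseg_a)]
      · obtain ⟨u, -, -, hu, h1⟩ := hs.exists_child hzb
        rw [h1, hu.isDescendant_iff_of_not_onSegment hw]
    · rw [reverseParent_of_not_onSegment hs, ← isDescendant_iff]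

/-- A node of `T_a` enters the segment at its lowest ancestor `s` there, and then moves down. It
meets `w` exactly when `s` is `w` or an ancestor of `w`, which the quantifier over `v` expresses
without naming `s`. -/
theorem reverse_isDescendant_of_onSegment {w : V} (hw : T.OnSegment a b w) (z : V) :
    (reverse hab).IsDescendant z w ↔
      T.IsDescendant z a ∧ ∀ v, T.OnSegment a b v → T.IsDescendant z v → T.IsDescendant w v := by
  have hD : ∀ z, T.OnSegment a b z → ((T.IsDescendant z a ∧
      ∀ v, T.OnSegment a b v → T.IsDescendant z v → T.IsDescendant w v) ↔
        T.IsDescendant w z) := fun z hz =>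
    ⟨fun h => h.2 z hz (T.isDescendant_refl z), fun h =>
      ⟨hz.2, fun v _ hv => IsDescendant.trans T h hv⟩⟩
  have hDb : T.IsDescendant w b ↔ b = w :=
    ⟨fun h => IsDescendant.antisymm T hw.1 h, fun h => h ▸ T.isDescendant_refl b⟩
  have hseg_b : T.OnSegment a b b := ⟨T.isDescendant_refl b, hab⟩
  refine isDescendant_iff_of_rec (D := fun z => T.IsDescendant z a ∧
    ∀ v, T.OnSegment a b v → T.IsDescendant z v → T.IsDescendant w v) ?_ (fun z hz => ?_) z
  · rw [reverse_root]
    by_cases ha : a = T.root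
    · rw [reverseRoot_of_eq ha, hD b hseg_b, hDb]
    · rw [reverseRoot_of_ne ha]
      refine iff_of_false (fun h => ha (isDescendant_root_iff.1 h.1).symm) ?_
      rintro rfl
      exact ha (isDescendant_root_iff.1 hw.2).symm
  · rw [reverse_parent]
    by_cases hs : T.OnSegment a b z
    · rw [hD z hs]
      by_cases hzb : z = b
      · subst hzb
        have ha : a ≠ T.root := fun h => hz (reverseRoot_of_eq h).symm
        rw [reverseParent_bottom_of_ne hab ha, hDb, or_iff_left]
        exact fun h => not_isDescendant_parent ha h.1
      · obtain ⟨u, hur, rfl, hu, h1⟩ := hs.exists_child hzb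
        rw [h1, hD u hu]
        constructor
        · intro h2
          rcases IsDescendant.total T hw.1 hu.1 with h3 | h3
          · exact Or.inr h3
          · rcases eq_or_ne u w with rfl | hne
            · exact Or.inr (T.isDescendant_refl _)
            · exact Or.inl (IsDescendant.antisymm T (h3.parent_of_ne hne) h2)
        · rintro (rfl | h2)
          · exact T.isDescendant_refl _
          · exact IsDescendant.trans T h2 (T.isDescendant_parent u)
    · have hne : ∀ {v}, T.OnSegment a b v → z ≠ v := by
        rintro v hv rfl
        exact hs hv
      have hpar : ∀ {v}, T.OnSegment a b v →
          (T.IsDescendant z v ↔ T.IsDescendant (T.parent z) v) := fun hv => by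
        rw [isDescendant_iff, or_iff_right (hne hv)]
      rw [reverseParent_of_not_onSegment hs, or_iff_right (hne hw),
        hpar ⟨hab, T.isDescendant_refl a⟩]
      exact and_congr_right fun _ => forall₂_congr fun v hv => by rw [hpar hv]

theorem reverse_isDescendant_bottom (z : V) :
    (reverse hab).IsDescendant z b ↔ T.IsDescendant z a := by
  rw [reverse_isDescendant_of_onSegment hab ⟨T.isDescendant_refl b, hab⟩]
  exact and_iff_left fun v hv _ => hv.1

theorem OnSegment.reverse_isDescendant_top {z : V} (hz : T.OnSegment a b z) :
    (reverse hab).IsDescendant a z :=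
  (reverse_isDescendant_of_onSegment hab hz a).2
    ⟨T.isDescendant_refl a, fun _ _ h => IsDescendant.trans T hz.2 h⟩

theorem reverse_top_bottom : (reverse hab).IsDescendant a b :=
  (reverse_isDescendant_bottom hab a).2 (T.isDescendant_refl a)

theorem reverse_onSegment {z : V} : (reverse hab).OnSegment b a z ↔ T.OnSegment a b z := by
  rw [OnSegment, reverse_isDescendant_bottom]
  refine ⟨fun h => ?_, fun h => ⟨h.reverse_isDescendant_top hab, h.2⟩⟩
  by_contra hz
  rw [reverse_isDescendant_of_not_onSegment hab hz] at h
  rw [← IsDescendant.antisymm T h.1 h.2] at hz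
  exact hz ⟨hab, T.isDescendant_refl a⟩

theorem bottom_ne_reverse_root_iff : b ≠ (reverse hab).root ↔ a ≠ T.root := by
  rw [reverse_root]
  by_cases ha : a = T.root
  · simp [ha, reverseRoot_of_eq]
  · rw [reverseRoot_of_ne ha]
    refine iff_of_true ?_ ha
    rintro rfl
    exact ha (isDescendant_root_iff.1 hab).symm

theorem ne_reverse_root_iff {z : V} (hz : ¬ T.OnSegment a b z) :
    z ≠ (reverse hab).root ↔ z ≠ T.root := by
  rw [reverse_root]
  by_cases ha : a = T.root
  · rw [reverseRoot_of_eq ha]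
    refine iff_of_true ?_ ?_ <;> rintro rfl <;> apply hz
    · exact ⟨T.isDescendant_refl z, hab⟩
    · exact ha ▸ ⟨hab, T.isDescendant_refl a⟩
  · rw [reverseRoot_of_ne ha]

theorem OnSegment.ne_reverse_root {z : V} (hz : T.OnSegment a b z) (hzb : z ≠ b) :
    z ≠ (reverse hab).root := by
  rw [reverse_root]
  by_cases ha : a = T.root
  · rwa [reverseRoot_of_eq ha]
  · rw [reverseRoot_of_ne ha]
    rintro rfl
    exact ha (isDescendant_root_iff.1 hz.2).symm

theorem reverse_reverse : reverse (reverse_top_bottom hab) = T := by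
  ext z
  · by_cases ha : a = T.root
    · rw [reverse_root, reverseRoot_of_eq, ha]
      rw [reverse_root, reverseRoot_of_eq ha]
    · rw [reverse_root, reverseRoot_of_ne ((bottom_ne_reverse_root_iff hab).2 ha), reverse_root,
        reverseRoot_of_ne ha]
  · rw [reverse_parent]
    by_cases hz : T.OnSegment a b z
    · by_cases hza : z = a
      · subst hza
        by_cases ha : z = T.root
        · rw [reverseParent_bottom_of_eq, ha, T.parent_root]
          rw [reverse_root, reverseRoot_of_eq ha]
        · rw [reverseParent_bottom_of_ne (reverse_top_bottom hab)
            ((bottom_ne_reverse_root_iff hab).2 ha), reverse_parent,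
            reverseParent_bottom_of_ne hab ha]
      · have hr := hz.2.ne_root hza
        have hpa := hz.2.parent_of_ne hza
        have hp : T.OnSegment a b (T.parent z) :=
          ⟨IsDescendant.trans T hz.1 (T.isDescendant_parent z), hpa⟩
        have hpb : T.parent z ≠ b := fun h => not_isDescendant_parent hr (h ▸ hz.1)
        have h1 : (reverse hab).parent (T.parent z) = z := reverseParent_parent hr hz.1 hpa
        have h2 := reverseParent_parent (T := reverse hab) (hp.ne_reverse_root hab hpb)
          (hp.reverse_isDescendant_top hab) (a := b)
          (by rw [h1]; exact (reverse_isDescendant_bottom hab z).2 hz.2)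
        rwa [h1] at h2
    · rw [reverseParent_of_not_onSegment (mt (reverse_onSegment hab).1 hz), reverse_parent,
        reverseParent_of_not_onSegment hz]

end Reverse

end RootedLabeledTree

namespace RootedLabeledTree

/-! ### Lowering along the lowest proper edge. -/

section LowestProper

variable {V : Type*} [Fintype V] [LinearOrder V] [BoundedOrder V] {T : RootedLabeledTree V} {y : V}

variable (T) in
/-- `y` is the child node of the lowest proper edge on the path from `⊤` to the root. -/
def IsLowestProper (y : V) : Prop :=
  T.IsProper y ∧ T.IsDescendant ⊤ y ∧ ∀ z, T.IsProper z → T.IsDescendant ⊤ z → T.IsDescendant y z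

theorem IsLowestProper.unique {z : V} (hy : T.IsLowestProper y) (hz : T.IsLowestProper z) :
    y = z :=
  IsDescendant.antisymm T (hy.2.2 z hz.1 hz.2.1) (hz.2.2 y hy.1 hy.2.1)

theorem IsLowerCritical.unique {z : V} (hy : T.IsLowerCritical y) (hz : T.IsLowerCritical z) :
    y = z :=
  IsDescendant.antisymm T (hz.2 y hy.1) (hy.2 z hz.1)

theorem exists_isLowestProper (h : 0 < T.numProperOnPath ⊤) : ∃ y, T.IsLowestProper y := by
  obtain ⟨y, ⟨hy1, hy2⟩, hmin⟩ := Set.exists_min_image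
    {y | T.IsDescendant ⊤ y ∧ T.IsProper y} (fun y => (T.subtree y).card) (Set.toFinite _)
    ((numProperOnPath_pos_iff T).1 h)
  refine ⟨y, hy2, hy1, fun z hz hz1 => ?_⟩
  rcases IsDescendant.total T hy1 hz1 with h1 | h1
  · exact h1
  · have hsub : T.subtree z ⊆ T.subtree y := fun v hv =>
      T.mem_subtree.2 (IsDescendant.trans T (T.mem_subtree.1 hv) h1)
    have heq := Finset.eq_of_subset_of_card_le hsub (hmin z ⟨hz1, hz⟩)
    exact T.mem_subtree.1 (heq ▸ T.mem_subtree.2 (T.isDescendant_refl y))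

variable (hy : T.IsLowestProper y)
include hy

theorem IsLowestProper.isDescendant_parent : T.IsDescendant ⊤ (T.parent y) :=
  IsDescendant.trans T hy.2.1 (T.isDescendant_parent y)

theorem IsLowestProper.parent_ne_top : T.parent y ≠ ⊤ :=
  (hy.1.parent_lt hy.2.1).ne

theorem IsLowestProper.onSegment : T.OnSegment (T.parent y) ⊤ y :=
  ⟨hy.2.1, T.isDescendant_parent y⟩

theorem IsLowestProper.isDescendant_of_onSegment {z : V} (hz : T.OnSegment (T.parent y) ⊤ z)
    (hne : z ≠ T.parent y) : T.IsDescendant z y := by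
  rcases IsDescendant.total T hy.2.1 hz.1 with h | h
  · rcases eq_or_ne y z with rfl | hyz
    · exact T.isDescendant_refl y
    · exact absurd (IsDescendant.antisymm T hz.2 (h.parent_of_ne hyz)) hne
  · exact h

theorem IsLowestProper.not_isProper_of_onSegment {z : V} (hz : T.OnSegment (T.parent y) ⊤ z)
    (hne : z ≠ T.parent y) (hzy : z ≠ y) : ¬ T.IsProper z := fun h =>
  hzy (IsDescendant.antisymm T (hy.isDescendant_of_onSegment hz hne) (hy.2.2 z h hz.1))

/-- The new father of `z` was a node of `T_y`, while the smaller node `T.parent y` now lies below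
`z`. -/
theorem IsLowestProper.reverse_isImproper {z : V} (hz : T.OnSegment (T.parent y) ⊤ z)
    (hne : z ≠ ⊤) : (reverse hy.isDescendant_parent).IsImproper z := by
  refine isImproper_iff.2 ⟨hz.ne_reverse_root _ hne, fun h => ?_⟩
  obtain ⟨u, hu, rfl, hsu, h1⟩ := hz.exists_child hne
  have h2 := h.parent_lt (hz.reverse_isDescendant_top hy.isDescendant_parent)
  rw [reverse_parent, h1] at h2
  refine lt_asymm h2 (hy.1.parent_lt (hy.isDescendant_of_onSegment hsu ?_))
  intro h3
  exact not_isDescendant_parent hu (h3 ▸ hz.2)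

theorem IsLowestProper.reverse_isProper {z : V} (hz : ¬ T.OnSegment (T.parent y) ⊤ z) :
    (reverse hy.isDescendant_parent).IsProper z ↔ T.IsProper z := by
  simp only [isProper_iff, ne_reverse_root_iff _ hz, reverse_isDescendant_of_not_onSegment _ hz,
    reverse_parent, reverseParent_of_not_onSegment hz]

theorem IsLowestProper.reverse_isProper_top :
    (reverse hy.isDescendant_parent).IsProper ⊤ ↔ T.IsProper (T.parent y) := by
  simp only [isProper_iff, bottom_ne_reverse_root_iff, reverse_isDescendant_bottom]
  refine and_congr_right fun hr => ?_
  rw [reverse_parent, reverseParent_bottom_of_ne hy.isDescendant_parent hr]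

/-- Edges are indexed by their child nodes, and the swap matches the old index set with the new one:
the edge above `T.parent y` becomes the edge above `⊤`, and the reversed edges lose the child `⊤`
and gain the child `T.parent y`. Under this matching only `y` changes status. -/
theorem IsLowestProper.reverse_isImproper_swap (z : V) :
    (reverse hy.isDescendant_parent).IsImproper (Equiv.swap (T.parent y) ⊤ z) ↔
      z = y ∨ T.IsImproper z := by
  have hpy : T.parent y ≠ y := parent_ne_self hy.1.1
  by_cases hz : T.OnSegment (T.parent y) ⊤ z
  · by_cases hzx : z = T.parent y
    · rw [hzx, Equiv.swap_apply_left, or_iff_right hpy, isImproper_iff, isImproper_iff,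
        bottom_ne_reverse_root_iff, hy.reverse_isProper_top]
    · refine iff_of_true ?_ ?_
      · by_cases hzt : z = ⊤
        · rw [hzt, Equiv.swap_apply_right]
          exact hy.reverse_isImproper ⟨hy.isDescendant_parent, T.isDescendant_refl _⟩
            hy.parent_ne_top
        · rw [Equiv.swap_apply_of_ne_of_ne hzx hzt]
          exact hy.reverse_isImproper hz hzt
      · refine or_iff_not_imp_left.2 fun hzy => isImproper_iff.2 ⟨?_, ?_⟩
        · exact hz.2.ne_root hzx
        · exact hy.not_isProper_of_onSegment hz hzx hzy
  · have h1 : z ≠ T.parent y := by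
      rintro rfl
      exact hz ⟨hy.isDescendant_parent, T.isDescendant_refl _⟩
    have h2 : z ≠ ⊤ := by
      rintro rfl
      exact hz ⟨T.isDescendant_refl _, hy.isDescendant_parent⟩
    have h3 : z ≠ y := by
      rintro rfl
      exact hz hy.onSegment
    rw [Equiv.swap_apply_of_ne_of_ne h1 h2, or_iff_right h3, isImproper_iff, isImproper_iff,
      ne_reverse_root_iff _ hz, hy.reverse_isProper hz]

theorem IsLowestProper.reverse_numImproper :
    (reverse hy.isDescendant_parent).numImproper = T.numImproper + 1 := by
  have hns : y ∉ {z | T.IsImproper z} := fun h => (isImproper_iff.1 h).2 hy.1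
  rw [numImproper_eq_ncard, numImproper_eq_ncard, ← Set.ncard_insert_of_notMem hns,
    ← Set.ncard_image_of_injective (insert y _) (Equiv.swap (T.parent y) ⊤).injective]
  congr 1
  ext z
  obtain ⟨z, rfl⟩ := (Equiv.swap (T.parent y) ⊤).surjective z
  rw [(Equiv.injective _).mem_set_image]
  exact hy.reverse_isImproper_swap z

theorem IsLowestProper.reverse_onPath_swap (z : V) :
    ((reverse hy.isDescendant_parent).IsDescendant ⊤ (Equiv.swap (T.parent y) ⊤ z) ∧
      (reverse hy.isDescendant_parent).IsProper (Equiv.swap (T.parent y) ⊤ z)) ↔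
      (T.IsDescendant ⊤ z ∧ T.IsProper z) ∧ z ≠ y := by
  have hpy : T.parent y ≠ y := parent_ne_self hy.1.1
  by_cases hz : T.OnSegment (T.parent y) ⊤ z
  · by_cases hzx : z = T.parent y
    · rw [hzx, Equiv.swap_apply_left, and_iff_left hpy, hy.reverse_isProper_top,
        and_iff_right hy.isDescendant_parent, and_iff_right (isDescendant_refl _ _)]
    · refine iff_of_false (fun h => ?_) fun h =>
        hy.not_isProper_of_onSegment hz hzx h.2 h.1.2
      have h1 := (hy.reverse_isImproper_swap z).not.1 fun h2 => (isImproper_iff.1 h2).2 h.2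
      rw [not_or, isImproper_iff, not_and, not_not] at h1
      exact hy.not_isProper_of_onSegment hz hzx h1.1 (h1.2 (hz.2.ne_root hzx))
  · have h1 : z ≠ T.parent y := by
      rintro rfl
      exact hz ⟨hy.isDescendant_parent, T.isDescendant_refl _⟩
    have h2 : z ≠ ⊤ := by
      rintro rfl
      exact hz ⟨T.isDescendant_refl _, hy.isDescendant_parent⟩
    have h3 : z ≠ y := by
      rintro rfl
      exact hz hy.onSegment
    rw [Equiv.swap_apply_of_ne_of_ne h1 h2, and_iff_left h3, hy.reverse_isProper hz,
      reverse_isDescendant_of_not_onSegment _ hz]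

theorem IsLowestProper.reverse_numProperOnPath :
    (reverse hy.isDescendant_parent).numProperOnPath ⊤ + 1 = T.numProperOnPath ⊤ := by
  rw [numProperOnPath_eq_ncard, numProperOnPath_eq_ncard,
    ← Set.ncard_sdiff_singleton_add_one (a := y) (s := {z | T.IsDescendant ⊤ z ∧ T.IsProper z})
      ⟨hy.2.1, hy.1⟩,
    ← Set.ncard_image_of_injective (_ \ {y}) (Equiv.swap (T.parent y) ⊤).injective]
  congr 2
  ext z
  obtain ⟨z, rfl⟩ := (Equiv.swap (T.parent y) ⊤).surjective z
  rw [(Equiv.injective _).mem_set_image]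
  exact hy.reverse_onPath_swap z

/-- The nodes below `⊤` but not below `T.parent y` are now those of the old `T_y`, all larger than
`T.parent y`. A candidate met earlier would be the father, in `T`, of an edge on the path that is
improper by the choice of `y`; a small node below that edge refutes it. -/
theorem IsLowestProper.reverse_isLowerCritical :
    (reverse hy.isDescendant_parent).IsLowerCritical (T.parent y) := by
  set S := reverse hy.isDescendant_parent with hS
  have hx : T.OnSegment (T.parent y) ⊤ (T.parent y) :=
    ⟨hy.isDescendant_parent, T.isDescendant_refl _⟩
  have hbot : ∀ z, S.IsDescendant z ⊤ ↔ T.IsDescendant z (T.parent y) :=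
    reverse_isDescendant_bottom _
  have htop : ∀ z, S.IsDescendant z (T.parent y) ↔
      T.IsDescendant z (T.parent y) ∧ ¬ T.IsDescendant z y := by
    intro z
    rw [hS, reverse_isDescendant_of_onSegment _ hx]
    refine and_congr_right fun hz => ⟨fun h h1 => ?_, fun h v hv hzv => ?_⟩
    · exact not_isDescendant_parent hy.1.1 (h y hy.onSegment h1)
    · by_cases hvx : v = T.parent y
      · exact hvx ▸ T.isDescendant_refl _
      · exact absurd (IsDescendant.trans T hzv (hy.isDescendant_of_onSegment hv hvx)) h
  have hbeta := S.mem_subtree.1 (S.beta_mem ⊤)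
  have hbx : S.IsDescendant (S.beta ⊤) (T.parent y) := by
    refine (htop _).2 ⟨(hbot _).1 hbeta, fun h => ?_⟩
    exact (hy.1.parent_lt h).not_ge
      (S.beta_le (S.mem_subtree.2 ((hbot _).2 (T.isDescendant_refl _))))
  refine ⟨⟨hy.parent_ne_top, (hbot _).2 (T.isDescendant_refl _), hbx, fun z hz => ?_⟩,
    fun w ⟨hwt, hw, hbw, hlt⟩ => ?_⟩
  · simp only [Finset.mem_sdiff, mem_subtree] at hz
    rw [htop, hbot, not_and, not_not] at hz
    exact hy.1.parent_lt (hz.2 hz.1)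
  · rcases IsDescendant.total S hbw hbx with h | h
    · exact h
    by_cases hs : T.OnSegment (T.parent y) ⊤ w
    · by_cases hwx : w = T.parent y
      · exact hwx ▸ S.isDescendant_refl _
      exfalso
      obtain ⟨u, hu, rfl, hsu, -⟩ := hs.exists_child hwt
      have hux : u ≠ T.parent y := fun h1 => not_isDescendant_parent hu (h1 ▸ hs.2)
      have huy : u ≠ y := fun h1 => hwx (h1 ▸ rfl)
      have himp := hy.not_isProper_of_onSegment hsu hux huy
      rw [isProper_iff] at himp
      push Not at himp
      obtain ⟨z, hzu, hz⟩ := himp hu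
      refine hz.not_gt (hlt z ?_)
      simp only [Finset.mem_sdiff, mem_subtree]
      refine ⟨(hbot z).2 (IsDescendant.trans T hzu hsu.2), fun h1 => ?_⟩
      exact not_isDescendant_parent hu
        (((reverse_isDescendant_of_onSegment _ hs z).1 h1).2 u hsu hzu)
    · rw [hS, reverse_isDescendant_of_not_onSegment _ hs] at h
      rw [← IsDescendant.antisymm T h ((hbot w).1 hw)] at hs
      exact absurd hx hs

theorem IsLowestProper.deg_bot_pos_iff :
    0 < T.deg ⊥ ↔ 0 < (reverse hy.isDescendant_parent).deg ⊥ ∨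
      (reverse hy.isDescendant_parent).IsLowerCritical ⊥ := by
  by_cases hx : T.parent y = ⊥
  · exact iff_of_true ((deg_pos_iff T).2 ⟨y, hy.1.1, hx⟩)
      (Or.inr (by simpa only [hx] using hy.reverse_isLowerCritical))
  · rw [or_iff_left fun h => hx (hy.reverse_isLowerCritical.unique h), deg_pos_iff, deg_pos_iff]
    -- Other than `T.parent y`, the reversed path consists of nodes larger than it. So `⊥` is off
    -- the path and keeps its children, except that `⊤` may replace `T.parent y`.
    have hbot : ¬ T.OnSegment (T.parent y) ⊤ ⊥ := fun h =>
      not_lt_bot (hy.1.parent_lt (hy.isDescendant_of_onSegment h (Ne.symm hx)))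
    constructor
    · rintro ⟨z, hz, hzb⟩
      by_cases hs : T.OnSegment (T.parent y) ⊤ z
      · have hzx : z = T.parent y := by
          by_contra h
          exact hbot ⟨IsDescendant.trans T hs.1 (hzb ▸ T.isDescendant_parent z),
            hzb ▸ hs.2.parent_of_ne h⟩
        rw [hzx] at hz hzb
        exact ⟨⊤, (bottom_ne_reverse_root_iff _).2 hz,
          (reverseParent_bottom_of_ne hy.isDescendant_parent hz).trans hzb⟩
      · exact ⟨z, (ne_reverse_root_iff _ hs).2 hz, (reverseParent_of_not_onSegment hs).trans hzb⟩
    · rintro ⟨z, hz, hzb⟩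
      by_cases hs : T.OnSegment (T.parent y) ⊤ z
      · by_cases hzt : z = ⊤
        · rw [hzt, bottom_ne_reverse_root_iff] at hz
          rw [hzt, reverse_parent, reverseParent_bottom_of_ne hy.isDescendant_parent hz] at hzb
          exact ⟨_, hz, hzb⟩
        · obtain ⟨u, -, -, hu, h1⟩ := hs.exists_child hzt
          rw [reverse_parent, h1] at hzb
          exact absurd (hzb ▸ hu) hbot
      · exact ⟨z, (ne_reverse_root_iff _ hs).1 hz,
          (reverseParent_of_not_onSegment hs).symm.trans hzb⟩

end LowestProper

/-! ### Raising from the lower critical node, and the composite bijection. -/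

section LowerCritical

variable {V : Type*} [Fintype V] [LinearOrder V] [BoundedOrder V] {T : RootedLabeledTree V} {u : V}

theorem IsLowerCritical.isDescendant_top (hu : T.IsLowerCritical u) : T.IsDescendant u ⊤ :=
  hu.1.2.1

/-- The criterion for `u` says that the reversed edge with father `u` and child `T.parent u` is
proper. A proper reversed edge further down would make its father an earlier candidate, against the
choice of `u`. -/
theorem IsLowerCritical.exists_isLowestProper_reverse (hu : T.IsLowerCritical u) :
    ∃ y, (reverse hu.isDescendant_top).IsLowestProper y ∧
      (reverse hu.isDescendant_top).parent y = u := by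
  obtain ⟨⟨hut, hd, hbeta, hlt⟩, hmax⟩ := hu
  set S := reverse hd with hS
  have hur : u ≠ T.root := hd.ne_root hut
  have hyd : T.IsDescendant (T.parent u) ⊤ := hd.parent_of_ne hut
  have hyu : T.parent u ≠ u := parent_ne_self hur
  have hys : T.OnSegment ⊤ u (T.parent u) := ⟨T.isDescendant_parent u, hyd⟩
  have hpar : S.parent (T.parent u) = u := reverseParent_parent hur (T.isDescendant_refl u) hyd
  refine ⟨T.parent u, ⟨isProper_iff.2 ⟨hys.ne_reverse_root hd hyu, fun z hz => ?_⟩,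
    hys.reverse_isDescendant_top hd, fun z hz hzt => ?_⟩, hpar⟩
  · rw [hpar]
    rw [hS, reverse_isDescendant_of_onSegment hd hys] at hz
    refine hlt z ?_
    simp only [Finset.mem_sdiff, mem_subtree]
    refine ⟨hz.1, fun h => ?_⟩
    exact not_isDescendant_parent hur (hz.2 u ⟨T.isDescendant_refl u, hd⟩ h)
  · by_cases hs : T.OnSegment ⊤ u z
    · by_cases hzu : z = u
      · rw [hzu, hS, reverse_isDescendant_bottom]
        exact hyd
      · obtain ⟨p, hpr, rfl, hps, hp⟩ := hs.exists_child hzu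
        suffices hpu : p = u by
          rw [hpu]
          exact S.isDescendant_refl _
        have hcand : T.IsLowerCriticalCandidate p := by
          refine ⟨?_, hps.2, IsDescendant.trans T hbeta hps.1, fun w hw => ?_⟩
          · rintro rfl
            exact not_isDescendant_parent hpr hs.2
          · simp only [Finset.mem_sdiff, mem_subtree] at hw
            have h1 : S.IsDescendant w (T.parent p) := by
              refine (reverse_isDescendant_of_onSegment hd hs w).2 ⟨hw.1, fun v hv hwv => ?_⟩
              rcases IsDescendant.total T hps.1 hv.1 with h2 | h2
              · refine h2.parent_of_ne ?_
                rintro rfl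
                exact hw.2 hwv
              · exact absurd (IsDescendant.trans T hwv h2) hw.2
            have h2 := hz.parent_lt h1
            rwa [hS, reverse_parent, hp] at h2
        exact IsDescendant.antisymm T (hmax p hcand) hps.1
    · rw [hS, reverse_isDescendant_of_not_onSegment hd hs] at hzt ⊢
      exact IsDescendant.trans T hyd hzt

open Classical in
/-- Reverse the path from `⊤` to the father of the lowest proper edge above `⊤`. -/
noncomputable def lower (T : RootedLabeledTree V) : RootedLabeledTree V :=
  if h : ∃ y, T.IsLowestProper y then reverse h.choose_spec.isDescendant_parent else T

open Classical in
/-- Reverse the path from the lower critical node to `⊤`. -/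
noncomputable def raise (T : RootedLabeledTree V) : RootedLabeledTree V :=
  if h : ∃ u, T.IsLowerCritical u then reverse h.choose_spec.isDescendant_top else T

theorem lower_eq {y : V} (hy : T.IsLowestProper y) : T.lower = reverse hy.isDescendant_parent := by
  have h : ∃ y, T.IsLowestProper y := ⟨y, hy⟩
  rw [lower, dif_pos h]
  exact reverse_congr _ _ (congrArg T.parent (h.choose_spec.unique hy)) rfl

theorem raise_eq (hu : T.IsLowerCritical u) : T.raise = reverse hu.isDescendant_top := by
  have h : ∃ u, T.IsLowerCritical u := ⟨u, hu⟩
  rw [raise, dif_pos h]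
  exact reverse_congr _ _ rfl (h.choose_spec.unique hu)

theorem bijOn_lower :
    Set.BijOn (lower (V := V)) {T | 0 < T.numProperOnPath ⊤} {T | 0 < T.deg ⊤} := by
  refine Set.InvOn.bijOn (f' := raise) ⟨fun T hT => ?_, fun T hT => ?_⟩ (fun T hT => ?_)
    fun T hT => ?_
  · obtain ⟨y, hy⟩ := exists_isLowestProper hT
    rw [lower_eq hy, raise_eq hy.reverse_isLowerCritical]
    exact reverse_reverse _
  · obtain ⟨u, hu, -⟩ := T.existsUnique_isLowerCritical hT
    obtain ⟨y, hy, hyu⟩ := hu.exists_isLowestProper_reverse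
    rw [raise_eq hu, lower_eq hy]
    exact (reverse_congr _ (reverse_top_bottom hu.isDescendant_top) hyu rfl).trans
      (reverse_reverse _)
  · obtain ⟨y, hy⟩ := exists_isLowestProper hT
    rw [lower_eq hy]
    exact hy.reverse_isLowerCritical.deg_pos
  · obtain ⟨u, hu, -⟩ := T.existsUnique_isLowerCritical hT
    obtain ⟨y, hy, -⟩ := hu.exists_isLowestProper_reverse
    rw [raise_eq hu]
    exact (numProperOnPath_pos_iff _).2 ⟨y, hy.2.1, hy.1⟩

variable (V) in
/-- A bijection of trees that turns the degree of `⊥` being positive into that of `⊤`. -/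
theorem exists_bijOn_deg_pos [SuccOrder V] [IsSuccArchimedean V] (hV : (⊥ : V) ≠ ⊤) :
    ∃ Φ : RootedLabeledTree V → RootedLabeledTree V,
      Set.BijOn Φ {T | 0 < T.deg ⊥} {T | 0 < T.deg ⊤} ∧
      ∀ T, 0 < T.deg ⊥ → (Φ T).numImproper = T.numImproper + 1 ∧
        (0 < T.numProperOnPath ⊤ → (Φ T).numProperOnPath ⊤ + 1 = T.numProperOnPath ⊤ ∧
          (0 < (Φ T).deg ⊥ ∨ (Φ T).IsLowerCritical ⊥)) ∧
        (T.numProperOnPath ⊤ = 0 → (Φ T).numProperOnPath ⊤ + 1 = T.deg ⊥ ∧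
          ¬ (0 < (Φ T).deg ⊥ ∨ (Φ T).IsLowerCritical ⊥)) := by
  obtain ⟨τ, hτ⟩ := exists_perm_swap_deg_bot V hV
  have hpos : ∀ T : RootedLabeledTree V, 0 < T.deg ⊥ ↔ 0 < (τ T).numProperOnPath ⊤ := by
    intro T
    obtain ⟨-, h1, h2⟩ := hτ T
    by_cases hT : T.numProperOnPath ⊤ = 0 ∨ T.deg ⊥ = 0
    · rw [(h1 hT).2]
    · rw [(h2 hT).2]
      omega
  have hbij : Set.BijOn τ {T | 0 < T.deg ⊥} {T | 0 < T.numProperOnPath ⊤} := by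
    refine ⟨fun T hT => (hpos T).1 hT, τ.injective.injOn, fun T hT => ?_⟩
    refine ⟨τ.symm T, ?_, τ.apply_symm_apply T⟩
    rw [Set.mem_ofPred_eq, hpos, τ.apply_symm_apply]
    exact hT
  -- With `deg ⊥ > 0`, `τ` acts as the exchange exactly when there is no proper edge above `⊤`. Then
  -- `deg ⊥` becomes zero, and `deg_bot_pos_iff` rules out both alternatives after `lower`.
  refine ⟨lower ∘ τ, bijOn_lower.comp hbij, fun T hT => ?_⟩
  obtain ⟨h0, h1, h2⟩ := hτ T
  obtain ⟨y, hy⟩ := exists_isLowestProper ((hpos T).1 hT)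
  rw [Function.comp_apply, lower_eq hy, hy.reverse_numImproper, h0, hy.reverse_numProperOnPath,
    ← hy.deg_bot_pos_iff]
  refine ⟨rfl, fun h => ?_, fun h => ?_⟩
  · obtain ⟨h3, h4⟩ := h2 (by omega)
    exact ⟨h4, h3 ▸ hT⟩
  · obtain ⟨h3, h4⟩ := h1 (Or.inl h)
    exact ⟨h4, by omega⟩

theorem deg_eq_zero_and_exists_iff (hT : 0 < T.deg ⊤) :
    (T.deg ⊥ = 0 ∧ ∃ u, T.IsLowerCritical u ∧ ⊥ < u) ↔
      ¬ (0 < T.deg ⊥ ∨ T.IsLowerCritical ⊥) := by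
  rw [not_or, not_lt, Nat.le_zero]
  refine and_congr_right fun _ => ⟨fun ⟨u, hu, hlt⟩ h => hlt.ne (h.unique hu), fun h => ?_⟩
  obtain ⟨u, hu, -⟩ := T.existsUnique_isLowerCritical hT
  refine ⟨u, hu, bot_lt_iff_ne_bot.2 ?_⟩
  rintro rfl
  exact h hu

theorem deg_eq_zero_of_bot_eq_top (hV : (⊥ : V) = ⊤) (x : V) : T.deg x = 0 := by
  have := subsingleton_of_bot_eq_top hV
  by_contra h
  obtain ⟨y, hy, -⟩ := (deg_pos_iff T).1 (Nat.pos_of_ne_zero h)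
  exact hy (Subsingleton.elim _ _)

end LowerCritical

end RootedLabeledTree

/-! ### Restriction to the prescribed classes of trees. -/

theorem Set.BijOn.restrict_of_iff {α β : Type*} {f : α → β} {s s' : Set α} {t t' : Set β}
    (h : Set.BijOn f s t) (hs : s' ⊆ s) (ht : t' ⊆ t) (hf : ∀ x ∈ s, x ∈ s' ↔ f x ∈ t') :
    Set.BijOn f s' t' := by
  refine ⟨fun x hx => (hf x (hs hx)).1 hx, h.injOn.mono hs, fun y hy => ?_⟩
  obtain ⟨x, hx, rfl⟩ := h.surjOn (ht hy)
  exact ⟨x, (hf x hx).2 hy, rfl⟩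

theorem mainTheorem5 (n : ℕ) [NeZero n] (k : ℕ) :
    (∀ m : ℕ, 1 ≤ m →
      ∃ φ : RootedLabeledTree (Fin n) → RootedLabeledTree (Fin n),
        Set.BijOn φ
          {T | T ∈ RTreesPath n k 0 ∧ T.deg ⊥ = m}
          {T | T ∈ RTreesPath n (k + 1) (m - 1) ∧ 0 < T.deg ⊤ ∧
            T.deg ⊥ = 0 ∧ ∃ u, T.IsLowerCritical u ∧ ⊥ < u}) ∧
    (∃ Φ : RootedLabeledTree (Fin n) → RootedLabeledTree (Fin n),
      Set.BijOn Φ {T | T ∈ RTrees n k ∧ 0 < T.deg ⊥} {T | T ∈ RTrees n (k + 1) ∧ 0 < T.deg ⊤} ∧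
      (∀ i : ℕ, 1 ≤ i →
        Set.BijOn Φ
          {T | T ∈ RTreesPath n k i ∧ 0 < T.deg ⊥}
          {T | T ∈ RTreesPath n (k + 1) (i - 1) ∧ 0 < T.deg ⊤ ∧
            (0 < T.deg ⊥ ∨ T.IsLowerCritical ⊥)}) ∧
      (∀ m : ℕ, 1 ≤ m →
        Set.BijOn Φ
          {T | T ∈ RTreesPath n k 0 ∧ T.deg ⊥ = m}
          {T | T ∈ RTreesPath n (k + 1) (m - 1) ∧ 0 < T.deg ⊤ ∧
            T.deg ⊥ = 0 ∧ ∃ u, T.IsLowerCritical u ∧ ⊥ < u})) := by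
  suffices h : ∃ Φ : RootedLabeledTree (Fin n) → RootedLabeledTree (Fin n),
      Set.BijOn Φ {T | 0 < T.deg ⊥} {T | 0 < T.deg ⊤} ∧
      ∀ T, 0 < T.deg ⊥ → (Φ T).numImproper = T.numImproper + 1 ∧
        (0 < T.numProperOnPath ⊤ → (Φ T).numProperOnPath ⊤ + 1 = T.numProperOnPath ⊤ ∧
          (0 < (Φ T).deg ⊥ ∨ (Φ T).IsLowerCritical ⊥)) ∧
        (T.numProperOnPath ⊤ = 0 → (Φ T).numProperOnPath ⊤ + 1 = T.deg ⊥ ∧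
          ¬ (0 < (Φ T).deg ⊥ ∨ (Φ T).IsLowerCritical ⊥)) by
    obtain ⟨Φ, hΦ, hstat⟩ := h
    have hm : ∀ m : ℕ, 1 ≤ m →
        Set.BijOn Φ
          {T | T ∈ RTreesPath n k 0 ∧ T.deg ⊥ = m}
          {T | T ∈ RTreesPath n (k + 1) (m - 1) ∧ 0 < T.deg ⊤ ∧
            T.deg ⊥ = 0 ∧ ∃ u, T.IsLowerCritical u ∧ ⊥ < u} := by
      intro m hm
      refine hΦ.restrict_of_iff (fun T hT => by have := hT.2; simp only [Set.mem_ofPred_eq]; omega)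
        (fun T hT => hT.2.1) fun T hT => ?_
      obtain ⟨h1, h2, h3⟩ := hstat T hT
      have hdt : 0 < (Φ T).deg ⊤ := hΦ.mapsTo hT
      simp only [Set.mem_ofPred_eq, RTreesPath, RTrees]
      rw [RootedLabeledTree.deg_eq_zero_and_exists_iff hdt, and_iff_right hdt, h1]
      rcases Nat.eq_zero_or_pos (T.numProperOnPath ⊤) with h4 | h4
      · obtain ⟨h5, h6⟩ := h3 h4
        rw [and_iff_left h6]
        omega
      · obtain ⟨-, h6⟩ := h2 h4
        exact iff_of_false (fun h => h4.ne' h.1.2) fun h => h.2 h6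
    refine ⟨fun m h => ⟨Φ, hm m h⟩, Φ, ?_, fun i hi => ?_, hm⟩
    · refine hΦ.restrict_of_iff (fun T hT => hT.2) (fun T hT => hT.2) fun T hT => ?_
      have hdt : 0 < (Φ T).deg ⊤ := hΦ.mapsTo hT
      have h0 : 0 < T.deg ⊥ := hT
      simp only [Set.mem_ofPred_eq, RTrees]
      rw [(hstat T hT).1]
      omega
    · refine hΦ.restrict_of_iff (fun T hT => hT.2) (fun T hT => hT.2.1) fun T hT => ?_
      obtain ⟨h1, h2, h3⟩ := hstat T hT
      have hdt : 0 < (Φ T).deg ⊤ := hΦ.mapsTo hT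
      have h0 : 0 < T.deg ⊥ := hT
      simp only [Set.mem_ofPred_eq, RTreesPath, RTrees]
      rw [and_iff_right hdt, h1]
      rcases Nat.eq_zero_or_pos (T.numProperOnPath ⊤) with h4 | h4
      · obtain ⟨-, h6⟩ := h3 h4
        exact iff_of_false (fun h => by omega) fun h => h6 h.2
      · obtain ⟨h5, h6⟩ := h2 h4
        rw [and_iff_left h6]
        omega
  -- For `n = 1` there are no edges, so both sides are empty and any map will do.
  by_cases hV : (⊥ : Fin n) = ⊤
  · have hz : ∀ (T : RootedLabeledTree (Fin n)) x, T.deg x = 0 := fun T x =>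
      T.deg_eq_zero_of_bot_eq_top hV x
    exact ⟨id, by simp [hz], fun T hT => absurd (hz T ⊥) hT.ne'⟩
  · exact RootedLabeledTree.exists_bijOn_deg_pos (Fin n) hV
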